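/- Let $(N,g)$ be a connected Riemannian $3$-manifold with a Killing field $X$ that generates a one-parameter group $G_X=\{\phi_v\}_{v\in\mathbb R}$ of isometries, i.e. a smooth isometric action of $\mathbb R$ with infinitesimal generator $X$. Let $N_r$ be the set of points lying on principal orbits, i.e. the points near which the isotropy group is locally constant, and let $\omega=\|X\|_g$. A $G_X$-invariant surface is an immersion $f:M\to N$ of a $2$-manifold with $f(M)\subset N_r$ that is equivariant for an action of $\mathbb R$ on $M$. Let $f:M\to N$ be a $G_X$-invariant surface with natural parameters $(s,t)\in I\times J$ ($I,J$ nonempty open intervals): the $t$-curves run along orbits of $X$ and the induced metric is $ds^2+U(s)^2dt^2$, with $U>0$ smooth. Write $F_M(s,t)$ for the point of $N$ with parameters $(s,t)$. For $m\neq0$ and an open interval $I'\subset I$, call a smooth curve $\gamma:I'\to N_r$ an *$m$-profile* if $\omega(\gamma(s))=\pm m\,U(s)$ (that is, $\omega(\gamma(s))=|m|\,U(s)$) and the projection of $\gamma$ to the orbit space has unit speed (the component of $\gamma'$ orthogonal to $X$ has length $1$). For $s_0\in I'$ and $c\in\mathbb R$ put $$\psi(s,t)=\phi_{v(s,t)}(\gamma(s)),\qquad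 v(s,t)=c+\frac tm-\int_{s_0}^s\frac{g(X(\gamma(r)),\gamma'(r))}{m^2U(r)^2}\,dr .$$ 1. For every $m\ne0$ and every $m$-profile $\gamma$ on an open interval $I'\subset I$, the map $\psi$ is a $G_X$-invariant surface on the strip $I'\times\mathbb R$, on which the group acts by $(s,t)\mapsto(s,t+ma)$. The coordinates $(s,t)$ are natural parameters with induced metric $ds^2+U(s)^2dt^2$. Thus $\psi$ is isometric to $M$ by the correspondence of equal parameters $(s,t)\in I'\times J$. 2. Conversely, every map into $N_r$ given in natural parameters $(s,t)\in I'\times J'$ with induced metric $ds^2+U(s)^2dt^2$ ($I'\subset I$, $J'$ open intervals) equals such a $\psi$ for some $m\neq0$, some $m$-profile on $I'$, and some $s_0,c$. 3. If $m\ne0$, $s_1\in I$, $p\in N_r$, $\omega(p)=|m|U(s_1)$ and $|m\,U'(s_1)|<\|\nabla\omega(p)\|$, then there is an $m$-profile $\gamma$ on a neighbourhood of $s_1$ with $\gamma(s_1)=p$. 4. $M$ itself belongs to the family: there are $m_0\neq0$ and an $m_0$-profile $\gamma_0$ on $I$ such that $F_M=\psi$ on $I\times J$ for suitable $s_0,c$;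 here $m_0=1$ if $\partial_tF_M=X$. Moreover: * if $s_1\in I$ and $|m_0U'(s_1)|<\|\nabla\omega(\gamma_0(s_1))\|$, there are $\varepsilon,\delta>0$ and $m$-profiles $\gamma_m$ on the common interval $(s_1-\delta,s_1+\delta)\subset I$ for all $|m-m_0|<\varepsilon$ (all these $m$ being nonzero), jointly continuous in $(m,s)$, with $\gamma_{m_0}=\gamma_0$ there; * if $\nabla\omega$ does not vanish identically along $\gamma_0$, there are $s_2\in I$ and $m_1\neq m_0$ such that for every $m$ between $m_0$ and $m_1$ (inclusive) one has $m\neq 0$ and there is an $m$-profile on a neighbourhood of $s_2$. Thus the $G_X$-invariant surfaces locally isometric to $M$ with corresponding natural parameters form a family with parameter $m\ne0$ containing $M$. When $\nabla\omega$ vanishes along $M$, the family may reduce to $m=\pm m_0$. -/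

import Mathlib

open Set Filter Topology MeasureTheory
open scoped Manifold ContDiff Bundle

noncomputable section

namespace Bour

/-- Euclidean three-space, the model of the ambient manifold. -/
abbrev E3 : Type := EuclideanSpace ℝ (Fin 3)

/-- A smooth Riemannian metric on a three-dimensional manifold. -/
abbrev Metric (N : Type*) [TopologicalSpace N] [ChartedSpace E3 N] [IsManifold (𝓡 3) ∞ N] :=
  Bundle.ContMDiffRiemannianMetric (𝓡 3) ∞ E3 (fun p : N => TangentSpace (𝓡 3) p)

/-- A nonempty open interval of the real line, possibly unbounded. -/
structure IsOpenInterval (I : Set ℝ) : Prop where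
  isOpen : IsOpen I
  ordConnected : I.OrdConnected
  nonempty : I.Nonempty

section Ambient

variable {N : Type*} [TopologicalSpace N] [ChartedSpace E3 N] [IsManifold (𝓡 3) ∞ N]

/-- `X` is a Killing vector field of `(N, g)` and `φ` is the one-parameter group of isometries
`G_X` that it generates: `φ` is a smooth action of the additive group of the reals by isometries
of `g`, whose trajectories are the integral curves of `X`. -/
structure IsKillingFlow (g : Metric N) (X : (p : N) → TangentSpace (𝓡 3) p) (φ : ℝ → N → N) :
    Prop where
  contMDiff : ContMDiff (𝓘(ℝ, ℝ).prod (𝓡 3)) (𝓡 3) ∞ (fun z : ℝ × N => φ z.1 z.2)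
  map_zero : ∀ p, φ 0 p = p
  map_add : ∀ v v' p, φ (v + v') p = φ v (φ v' p)
  integralCurve : ∀ p, IsMIntegralCurve (I := 𝓡 3) (fun v => φ v p) X
  isometry : ∀ v p, ∀ w w' : TangentSpace (𝓡 3) p,
    g.inner (φ v p) (mfderiv (𝓡 3) (𝓡 3) (φ v) p w) (mfderiv (𝓡 3) (𝓡 3) (φ v) p w')
      = g.inner p w w'

/-- The isotropy group of `p`, as a set of times. -/
def isotropy (φ : ℝ → N → N) (p : N) : Set ℝ := {v | φ v p = p}

/-- The regular part of `N`: the points on principal orbits, i.e. the points near which all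
orbits have the same type. As the group is abelian, two orbits have the same type exactly if the
isotropy groups are equal. -/
def regularPart (φ : ℝ → N → N) : Set N := {p | ∀ᶠ q in 𝓝 p, isotropy φ q = isotropy φ p}

/-- The volume function `ω = ‖X‖` of the orbits. -/
def volumeFn (g : Metric N) (X : (p : N) → TangentSpace (𝓡 3) p) (p : N) : ℝ :=
  √(g.inner p (X p) (X p))

/-- The squared length, for the quotient metric on the orbit space, of the projection of the
tangent vector `w`, i.e. the squared length of the component of `w` orthogonal to `X`
(used only where `X` does not vanish). -/
def orbitNormSq (g : Metric N) (X : (p : N) → TangentSpace (𝓡 3) p) (p : N)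
    (w : TangentSpace (𝓡 3) p) : ℝ :=
  let h : TangentSpace (𝓡 3) p := w - (g.inner p w (X p) / g.inner p (X p) (X p)) • X p
  g.inner p h h

/-- `‖∇ω‖ > r` at the point `p` (for `r ≥ 0`): some tangent vector has `dω(w) > r ‖w‖`. -/
def GradVolumeGT (g : Metric N) (X : (p : N) → TangentSpace (𝓡 3) p) (p : N) (r : ℝ) : Prop :=
  ∃ w : TangentSpace (𝓡 3) p,
    r * √(g.inner p w w) < (mfderiv (𝓡 3) 𝓘(ℝ, ℝ) (volumeFn g X) p w : ℝ)

/-- The velocity of a curve. -/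
def velocity (γ : ℝ → N) (s : ℝ) : TangentSpace (𝓡 3) (γ s) :=
  mfderiv 𝓘(ℝ, ℝ) (𝓡 3) γ s (1 : ℝ)

/-- The first fundamental form, at `z`, of a map from the `(s, t)`-plane into `N`. -/
def firstForm (g : Metric N) (F : ℝ × ℝ → N) (z w w' : ℝ × ℝ) : ℝ :=
  g.inner (F z) (mfderiv 𝓘(ℝ, ℝ × ℝ) (𝓡 3) F z w) (mfderiv 𝓘(ℝ, ℝ × ℝ) (𝓡 3) F z w')

/-- `F` is given in natural parameters `(s, t)` on the open set `R`: the `t`-coordinate curves are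
tangent to `X` (they run along orbits), and the induced metric is `ds² + U(s)² dt²`. -/
structure IsNatural (g : Metric N) (X : (p : N) → TangentSpace (𝓡 3) p) (U : ℝ → ℝ)
    (R : Set (ℝ × ℝ)) (F : ℝ × ℝ → N) : Prop where
  contMDiffOn : ContMDiffOn 𝓘(ℝ, ℝ × ℝ) (𝓡 3) ∞ F R
  tangent : ∀ z ∈ R, ∃ k : ℝ,
    mfderiv 𝓘(ℝ, ℝ × ℝ) (𝓡 3) F z ((0, 1) : ℝ × ℝ) = k • X (F z)
  metric : ∀ z ∈ R, ∀ w w' : ℝ × ℝ,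
    firstForm g F z w w' = w.1 * w'.1 + U z.1 ^ 2 * (w.2 * w'.2)

/-- `f`, from a manifold `S` modelled on `E`, is an equivariant immersion into the regular part
of `N`, for the smooth action `θ` of the one-parameter group on `S`. -/
structure IsEquivariantImmersion {E : Type*} [NormedAddCommGroup E] [NormedSpace ℝ E]
    {S : Type*} [TopologicalSpace S] [ChartedSpace E S]
    (φ : ℝ → N → N) (θ : ℝ → S → S) (f : S → N) : Prop where
  contMDiff_action :
    ContMDiff (𝓘(ℝ, ℝ).prod 𝓘(ℝ, E)) 𝓘(ℝ, E) ∞ (fun z : ℝ × S => θ z.1 z.2)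
  action_zero : ∀ x, θ 0 x = x
  action_add : ∀ v v' x, θ (v + v') x = θ v (θ v' x)
  contMDiff : ContMDiff 𝓘(ℝ, E) (𝓡 3) ∞ f
  immersion : ∀ x, Function.Injective (mfderiv 𝓘(ℝ, E) (𝓡 3) f x)
  regular : ∀ x, f x ∈ regularPart φ
  equivariant : ∀ v x, f (θ v x) = φ v (f x)

/-- `γ`, defined on the interval `I`, is a lift to the regular part of `N` of a profile curve that
has unit speed in the orbit space and satisfies `ω = ± m U` (`ω` and `U` are positive). -/
structure IsProfile (g : Metric N) (X : (p : N) → TangentSpace (𝓡 3) p) (φ : ℝ → N → N)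
    (U : ℝ → ℝ) (m : ℝ) (I : Set ℝ) (γ : ℝ → N) : Prop where
  contMDiffOn : ContMDiffOn 𝓘(ℝ, ℝ) (𝓡 3) ∞ γ I
  regular : ∀ s ∈ I, γ s ∈ regularPart φ
  volume_eq : ∀ s ∈ I, volumeFn g X (γ s) = |m| * U s
  unit_speed : ∀ s ∈ I, orbitNormSq g X (γ s) (velocity γ s) = 1

/-- The function `v(s, t) = c + t / m - ∫ g(X(γ), γ') / (m² U²) ds`, integrated from `s₀`. -/
def bourTime (g : Metric N) (X : (p : N) → TangentSpace (𝓡 3) p) (U : ℝ → ℝ) (m : ℝ)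
    (γ : ℝ → N) (s₀ c : ℝ) (z : ℝ × ℝ) : ℝ :=
  c + z.2 / m - ∫ r in s₀..z.1, g.inner (γ r) (X (γ r)) (velocity γ r) / (m ^ 2 * U r ^ 2)

/-- The map `ψ(s, t) = φ_{v(s, t)}(γ(s))`. -/
def bourMap (g : Metric N) (X : (p : N) → TangentSpace (𝓡 3) p) (φ : ℝ → N → N) (U : ℝ → ℝ)
    (m : ℝ) (γ : ℝ → N) (s₀ c : ℝ) (z : ℝ × ℝ) : N :=
  φ (bourTime g X U m γ s₀ c z) (γ z.1)

end Ambient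

/-- The strip `I × ℝ` as an open subset of the `(s, t)`-plane. -/
def strip (I : Set ℝ) (hI : IsOpen I) : TopologicalSpace.Opens (ℝ × ℝ) :=
  ⟨I ×ˢ univ, hI.prod isOpen_univ⟩

/-- The action of the one-parameter group on a strip by `(s, t) ↦ (s, t + m v)`. -/
def stripAction (I : Set ℝ) (hI : IsOpen I) (m : ℝ) (v : ℝ) (z : strip I hI) : strip I hI :=
  ⟨(z.1.1, z.1.2 + m * v), ⟨z.2.1, mem_univ _⟩⟩

end Bour

end

namespace Bour

/-! ### The flow, its generator and the regular part -/

section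

/-! Write `ψ(s,t) = φ_v(γ(s))`. Since `dφ_v` is isometric and carries `X` to `X`, the first form of
`ψ` is that of the vectors `v_s X + γ'` and `v_t X` at `γ(s)`. The integral in `v` is chosen so that
`v_s X` cancels the `X`-component of `γ'`. What remains is the projection of `γ'` to the orbit
space, of length 1, and `X/m`, of length `ω/|m| = U`. This gives the metric `ds² + U² dt²`
(`bourMap_isNatural`).

Conversely, let `∂_t F = kX` (`exists_profile_of_isNatural`). Then `k²ω² = U(s)²`. As `ω` is
constant along orbits and `k` is continuous without zeros, `k` depends on `s` only, so `F(s,t) =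
φ_{k(s)(t-t₀)}(F(s,t₀))`. Orthogonality of `∂_s` and `∂_t` away from `t = t₀` forces `k' = 0`. Hence
`m = 1/k`, and `s ↦ F(s,t₀)` is a profile orthogonal to `X`.

For local existence, differentiating `ω(γ) = μU` with `μ = |m|` gives two equations for the
velocity: `dω(γ') = μU'` and unit length in the orbit space. If `|μU'| < ‖∇ω‖`, they are independent
by Cauchy-Schwarz, and the implicit function theorem solves them for a velocity within an affine
plane (`exists_implicit_velocity`). The result is an ODE depending on `μ`, which preserves `ω = μU`
once this holds initially (`exists_curve_family`). Taking the plane through the velocity of a known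
profile makes that profile a solution, so uniqueness puts it in the family
(`exists_profile_family`). For a prescribed point, an initial velocity comes from turning a unit
vector orthogonal to `X` until `dω` takes the required value (`exists_unit_orthogonal`).

An interval of values of `m` exists even where `γ₀` is degenerate (`exists_profile_interval`). If
`U' = 0` at the given point, the hypothesis there is already nondegeneracy. Otherwise put `L = U'/U`
and start at time `s₂` from the point `γ₀(s)`, which requires `m = m₀U(s)/U(s₂)`. Since `γ₀` has
unit speed, `‖∇ω(γ₀(s))‖ ≥ |m₀U(s)L(s)|`, while `|mU'(s₂)| = |m₀U(s)L(s₂)|`; so `L(s₂)² < L(s)²`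
suffices. If `L²` is not locally constant, such an `s₂` serves a whole interval of `s`. If it is,
`U` is locally exponential, and translating the parameter of `γ₀` only rescales `m`. -/

theorem isOpen_regularPart {N : Type*} [TopologicalSpace N] (φ : ℝ → N → N) :
    IsOpen (regularPart φ) := by
  rw [isOpen_iff_mem_nhds]
  intro p hp
  have hp' : ∀ᶠ q in 𝓝 p, isotropy φ q = isotropy φ p := hp
  filter_upwards [eventually_eventually_nhds.2 hp', hp'] with q hq hqp
  filter_upwards [hq] with r hr
  rw [hr, hqp]

variable {N : Type*} [TopologicalSpace N] [ChartedSpace E3 N] [IsManifold (𝓡 3) ∞ N]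

theorem contMDiffOn_mfderiv {E' : Type*} [NormedAddCommGroup E'] [NormedSpace ℝ E']
    {F : E' → N} {S : Set E'} (hS : IsOpen S) (hF : ContMDiffOn 𝓘(ℝ, E') (𝓡 3) ∞ F S) :
    ContMDiffOn 𝓘(ℝ, E' × E') (𝓡 3).tangent ∞
      (fun z : E' × E' => (⟨F z.1, mfderiv 𝓘(ℝ, E') (𝓡 3) F z.1 z.2⟩ : TangentBundle (𝓡 3) N))
      (S ×ˢ univ) := by
  have h1 : ContMDiff 𝓘(ℝ, E' × E') 𝓘(ℝ, E').tangent ∞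
      (fun z : E' × E' => (⟨z.1, z.2⟩ : TangentBundle 𝓘(ℝ, E') E')) := by
    intro z
    rw [Bundle.contMDiffAt_totalSpace]
    refine ⟨contDiffAt_fst.contMDiffAt, ?_⟩
    simpa using contDiffAt_snd.contMDiffAt
  have h2 := (hF.contMDiffOn_tangentMapWithin (m := ∞) (by simp) hS.uniqueMDiffOn)
  have h3 := h2.comp h1.contMDiffOn (s := S ×ˢ univ) (fun z hz => hz.1)
  refine h3.congr (fun z hz => ?_)
  simp only [Function.comp, tangentMapWithin]
  rw [mfderivWithin_of_isOpen hS hz.1]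

theorem contMDiffAt_inner (g : Metric N) {E' : Type*} [NormedAddCommGroup E'] [NormedSpace ℝ E']
    {b : E' → N} {v w : ∀ x, TangentSpace (𝓡 3) (b x)} {x : E'}
    (hv : ContMDiffAt 𝓘(ℝ, E') (𝓡 3).tangent ∞ (fun x => (⟨b x, v x⟩ : TangentBundle (𝓡 3) N)) x)
    (hw : ContMDiffAt 𝓘(ℝ, E') (𝓡 3).tangent ∞ (fun x => (⟨b x, w x⟩ : TangentBundle (𝓡 3) N)) x) :
    ContDiffAt ℝ ∞ (fun x => g.inner (b x) (v x) (w x)) x := by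
  let _ : Bundle.RiemannianBundle (fun p : N => TangentSpace (𝓡 3) p) := ⟨g.toRiemannianMetric⟩
  have := ContMDiffAt.inner_bundle (IB := 𝓡 3) (n := ∞) (F := E3) hv hw
  exact contMDiffAt_iff_contDiffAt.1 this

namespace IsKillingFlow

variable {g : Metric N} {X : (p : N) → TangentSpace (𝓡 3) p} {φ : ℝ → N → N}

theorem mfderiv_time (hX : IsKillingFlow g X φ) (v : ℝ) (p : N) (a : ℝ) :
    mfderiv 𝓘(ℝ, ℝ) (𝓡 3) (fun v => φ v p) v a = a • X (φ v p) := by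
  rw [(hX.integralCurve p v).mfderiv]
  rfl

theorem contMDiff_flow (hX : IsKillingFlow g X φ) (v : ℝ) : ContMDiff (𝓡 3) (𝓡 3) ∞ (φ v) :=
  hX.contMDiff.comp (contMDiff_const.prodMk contMDiff_id)

theorem mfderiv_uncurry (hX : IsKillingFlow g X φ) (v : ℝ) (p : N) (a : ℝ)
    (w : TangentSpace (𝓡 3) p) :
    mfderiv (𝓘(ℝ, ℝ).prod (𝓡 3)) (𝓡 3) (fun z : ℝ × N => φ z.1 z.2) (v, p) (a, w)
      = a • X (φ v p) + mfderiv (𝓡 3) (𝓡 3) (φ v) p w := by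
  refine (mfderiv_prod_eq_add_apply (hX.contMDiff.mdifferentiable (by simp) (v, p))).trans ?_
  exact congrArg (· + mfderiv (𝓡 3) (𝓡 3) (φ v) p w) (hX.mfderiv_time v p a)

/-- Smoothness of `X` is not assumed: it follows because `X(p)` is the image of the tangent vector
`(1, 0)` at `(0, p)` under the tangent map of the smooth action. -/
theorem contMDiff_field (hX : IsKillingFlow g X φ) :
    ContMDiff (𝓡 3) (𝓡 3).tangent ∞ (fun p => (⟨p, X p⟩ : TangentBundle (𝓡 3) N)) := by
  have h1 := hX.contMDiff.contMDiff_tangentMap (m := ∞) (by simp)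
  have h2 : ContMDiff (𝓡 3) (𝓘(ℝ, ℝ).tangent.prod (𝓡 3).tangent) ∞
      (fun p : N => ((⟨0, 1⟩, ⟨p, 0⟩) : TangentBundle 𝓘(ℝ, ℝ) ℝ × TangentBundle (𝓡 3) N)) :=
    contMDiff_const.prodMk (Bundle.contMDiff_zeroSection ℝ (TangentSpace (𝓡 3) : N → Type _))
  have h3 := h1.comp (contMDiff_equivTangentBundleProd_symm.comp h2)
  convert h3 using 1
  ext1 p
  have h4 : mfderiv (𝓘(ℝ, ℝ).prod (𝓡 3)) (𝓡 3) (fun z : ℝ × N => φ z.1 z.2) (0, p) (1, 0)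
      = X (φ 0 p) := by
    refine (hX.mfderiv_uncurry 0 p 1 0).trans ?_
    rw [one_smul, _root_.map_zero, add_zero]
  calc (⟨p, X p⟩ : TangentBundle (𝓡 3) N) = ⟨φ 0 p, X (φ 0 p)⟩ := by rw [hX.map_zero]
    _ = ⟨φ 0 p, mfderiv (𝓘(ℝ, ℝ).prod (𝓡 3)) (𝓡 3) (fun z : ℝ × N => φ z.1 z.2) (0, p) (1, 0)⟩ := by
      rw [h4]

/-- Differentiate `φ_v φ_t = φ_t φ_v` in `t`. The computation is made at `φ t p` for every `t`, and
`φ 0 p` is replaced by `p` only at the end, since the tangent space depends on the point. -/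
theorem mfderiv_field (hX : IsKillingFlow g X φ) (v : ℝ) (p : N) :
    mfderiv (𝓡 3) (𝓡 3) (φ v) p (X p) = X (φ v p) := by
  have key : ∀ t : ℝ, mfderiv (𝓡 3) (𝓡 3) (φ v) (φ t p) (X (φ t p)) = X (φ v (φ t p)) := by
    intro t
    have h1 := mfderiv_comp_apply t ((hX.contMDiff_flow v).mdifferentiable (by simp) (φ t p))
      (hX.integralCurve p t).mdifferentiableAt (1 : ℝ)
    have h2 : (φ v ∘ fun t => φ t p) = fun t => φ t (φ v p) := by
      ext t
      rw [Function.comp_apply, ← hX.map_add, add_comm, hX.map_add]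
    rw [h2] at h1
    have h3 := hX.mfderiv_time t (φ v p) 1
    have h4 := hX.mfderiv_time t p 1
    rw [one_smul] at h3 h4
    have h5 : φ t (φ v p) = φ v (φ t p) := by rw [← hX.map_add, add_comm, hX.map_add]
    rw [← h5]
    rw [h4] at h1
    exact h1.symm.trans h3
  have h := key 0
  rwa [hX.map_zero] at h

/-- Invariance of `X` lets the time derivative be pulled inside `dφ`, so that inner products can be
computed at the unmoved point by `isometry`. -/
theorem mfderiv_flow_comp (hX : IsKillingFlow g X φ) {E' : Type*} [NormedAddCommGroup E']
    [NormedSpace ℝ E'] {a : E' → ℝ} {c : E' → N} {x : E'} (ha : DifferentiableAt ℝ a x)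
    (hc : MDifferentiableAt 𝓘(ℝ, E') (𝓡 3) c x) (w : E') :
    mfderiv 𝓘(ℝ, E') (𝓡 3) (fun x => φ (a x) (c x)) x w
      = mfderiv (𝓡 3) (𝓡 3) (φ (a x)) (c x)
          (fderiv ℝ a x w • X (c x) + mfderiv 𝓘(ℝ, E') (𝓡 3) c x w) := by
  have h1 := mfderiv_comp_apply (f := fun x => (a x, c x)) x
    (hX.contMDiff.mdifferentiable (by simp) (a x, c x))
    (ha.mdifferentiableAt.prodMk hc) w
  have h2 := mfderiv_prodMk ha.mdifferentiableAt hc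
  rw [h2] at h1
  refine h1.trans ?_
  refine (hX.mfderiv_uncurry (a x) (c x) (mfderiv 𝓘(ℝ, E') 𝓘(ℝ, ℝ) a x w)
    (mfderiv 𝓘(ℝ, E') (𝓡 3) c x w)).trans ?_
  refine Eq.symm ((_root_.map_add (mfderiv (𝓡 3) (𝓡 3) (φ (a x)) (c x)) _ _).trans ?_)
  rw [map_smul, hX.mfderiv_field, mfderiv_eq_fderiv]
  rfl

theorem isotropy_flow (hX : IsKillingFlow g X φ) (v : ℝ) (p : N) :
    isotropy φ (φ v p) = isotropy φ p := by
  ext u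
  simp only [isotropy, mem_ofPred_eq]
  rw [← hX.map_add, add_comm, hX.map_add]
  refine ⟨fun h => ?_, fun h => by rw [h]⟩
  have := congrArg (φ (-v)) h
  simpa only [← hX.map_add, neg_add_cancel, hX.map_zero, ← add_assoc, zero_add] using this

theorem flow_mem_regularPart (hX : IsKillingFlow g X φ) (v : ℝ) {p : N}
    (hp : p ∈ regularPart φ) : φ v p ∈ regularPart φ := by
  have h1 : Tendsto (φ (-v)) (𝓝 (φ v p)) (𝓝 p) := by
    have := ((hX.contMDiff_flow (-v)).continuous).tendsto (φ v p)
    rwa [← hX.map_add, neg_add_cancel, hX.map_zero] at this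
  filter_upwards [h1.eventually hp] with q hq
  rw [hX.isotropy_flow] at *
  exact hq

theorem inner_field_flow (hX : IsKillingFlow g X φ) (v : ℝ) (p : N) :
    g.inner (φ v p) (X (φ v p)) (X (φ v p)) = g.inner p (X p) (X p) := by
  rw [← hX.mfderiv_field, hX.isometry]

theorem volumeFn_flow (hX : IsKillingFlow g X φ) (v : ℝ) (p : N) :
    volumeFn g X (φ v p) = volumeFn g X p := by
  rw [volumeFn, hX.inner_field_flow, volumeFn]

end IsKillingFlow

variable {g : Metric N} {X : (p : N) → TangentSpace (𝓡 3) p}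

theorem inner_self_nonneg (g : Metric N) (p : N) (w : TangentSpace (𝓡 3) p) :
    0 ≤ g.inner p w w := by
  by_cases hw : w = 0
  · simp [hw]
  · exact (g.pos p w hw).le

theorem volumeFn_sq (p : N) : volumeFn g X p ^ 2 = g.inner p (X p) (X p) :=
  Real.sq_sqrt (inner_self_nonneg g p _)

theorem inner_field_pos_of_volumeFn_pos {p : N} (h : 0 < volumeFn g X p) :
    0 < g.inner p (X p) (X p) := Real.sqrt_pos.1 h

theorem orbitNormSq_eq (p : N) (w : TangentSpace (𝓡 3) p) (h : g.inner p (X p) (X p) ≠ 0) :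
    orbitNormSq g X p w
      = g.inner p w w - g.inner p w (X p) ^ 2 / g.inner p (X p) (X p) := by
  simp only [orbitNormSq, map_sub, map_smul, sub_apply,
    smul_apply, smul_eq_mul, g.symm p (X p) w]
  field_simp
  ring

end

/-! ### Surfaces generated by a profile -/

section

/-- The inclusion has a left inverse, extended by a constant outside `S`, which is smooth at the
point considered; the chain rule then gives a left inverse of the derivative. -/
theorem mfderiv_opens_coe_injective {E : Type*} [NormedAddCommGroup E] [NormedSpace ℝ E]
    (S : TopologicalSpace.Opens E) (x : S) :
    Function.Injective (mfderiv 𝓘(ℝ, E) 𝓘(ℝ, E) (Subtype.val : S → E) x) := by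
  have hval : MDifferentiableAt 𝓘(ℝ, E) 𝓘(ℝ, E) (Subtype.val : S → E) x :=
    (contMDiff_subtype_val (n := 1)).mdifferentiable (by simp) x
  classical
  let r : E → S := fun y => if h : y ∈ S then ⟨y, h⟩ else x
  have hr : (fun y => (r y : E)) =ᶠ[𝓝 (x : E)] id := by
    filter_upwards [S.isOpen.mem_nhds x.2] with y hy
    have hy' : y ∈ S := hy
    simp [r, hy']
  have hr' : ContMDiffAt 𝓘(ℝ, E) 𝓘(ℝ, E) ∞ r (x : E) := by
    rw [← ContMDiffAt.subtypeVal_comp_iff]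
    exact contMDiffAt_id.congr_of_eventuallyEq hr
  have hrx : r x = x := by simp [r]
  have hrs : r ∘ (Subtype.val : S → E) = id := by
    ext y
    simp [r]
  have h1 := mfderiv_comp_of_eq (x := x) (hr'.mdifferentiableAt (by simp)) hval rfl
  rw [hrs, mfderiv_id] at h1
  intro v w hvw
  have h2 := congrArg (mfderiv 𝓘(ℝ, E) 𝓘(ℝ, E) r x) hvw
  have h3 := fun u => congrArg (fun L => L u) h1
  exact (h3 v).trans (h2.trans (h3 w).symm)

theorem contDiffOn_integral {h : ℝ → ℝ} {I : Set ℝ} (hI : IsOpenInterval I)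
    (hh : ContDiffOn ℝ ∞ h I) {s₀ : ℝ} (hs₀ : s₀ ∈ I) :
    ContDiffOn ℝ ∞ (fun s => ∫ r in s₀..s, h r) I ∧
      ∀ s ∈ I, HasDerivAt (fun s => ∫ r in s₀..s, h r) (h s) s := by
  have hd : ∀ s ∈ I, HasDerivAt (fun s => ∫ r in s₀..s, h r) (h s) s := by
    intro s hs
    have := hI.ordConnected
    refine intervalIntegral.integral_hasDerivAt_right
      (hh.continuousOn.mono (OrdConnected.uIcc_subset this hs₀ hs)).intervalIntegrable
      (hh.continuousOn.stronglyMeasurableAtFilter hI.isOpen s hs)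
      (hh.continuousOn.continuousAt (hI.isOpen.mem_nhds hs))
  refine ⟨?_, hd⟩
  rw [contDiffOn_infty_iff_deriv_of_isOpen hI.isOpen]
  exact ⟨fun s hs => (hd s hs).differentiableAt.differentiableWithinAt,
    hh.congr fun s hs => (hd s hs).deriv⟩

theorem mfderiv_comp_fst {N : Type*} [TopologicalSpace N] [ChartedSpace E3 N]
    {γ : ℝ → N} {z : ℝ × ℝ}
    (hγ : MDifferentiableAt 𝓘(ℝ, ℝ) (𝓡 3) γ z.1) (w : ℝ × ℝ) :
    mfderiv 𝓘(ℝ, ℝ × ℝ) (𝓡 3) (fun z : ℝ × ℝ => γ z.1) z w = w.1 • velocity γ z.1 := by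
  have h1 := mfderiv_comp_apply (I := 𝓘(ℝ, ℝ × ℝ)) (I' := 𝓘(ℝ, ℝ)) (f := Prod.fst) z hγ
    differentiableAt_fst.mdifferentiableAt w
  rw [mfderiv_eq_fderiv, fderiv_fst] at h1
  refine h1.trans ?_
  have h2 := (mfderiv 𝓘(ℝ, ℝ) (𝓡 3) γ z.1).map_smul w.1 (1 : ℝ)
  refine Eq.trans ?_ h2
  congr 1
  exact (mul_one w.1).symm

variable {N : Type*} [TopologicalSpace N] [ChartedSpace E3 N] [IsManifold (𝓡 3) ∞ N]
  {g : Metric N} {X : (p : N) → TangentSpace (𝓡 3) p} {φ : ℝ → N → N}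

theorem contMDiffOn_velocity {γ : ℝ → N} {I : Set ℝ} (hI : IsOpen I)
    (hγ : ContMDiffOn 𝓘(ℝ, ℝ) (𝓡 3) ∞ γ I) :
    ContMDiffOn 𝓘(ℝ, ℝ) (𝓡 3).tangent ∞
      (fun s => (⟨γ s, velocity γ s⟩ : TangentBundle (𝓡 3) N)) I :=
  (contMDiffOn_mfderiv hI hγ).comp
    (f := fun s : ℝ => (s, (1 : ℝ))) (contDiff_id.prodMk contDiff_const).contMDiff.contMDiffOn
    (fun _ hs => ⟨hs, mem_univ _⟩)

theorem contDiffOn_inner_velocity (hX : IsKillingFlow g X φ) {γ : ℝ → N} {I : Set ℝ}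
    (hI : IsOpen I) (hγ : ContMDiffOn 𝓘(ℝ, ℝ) (𝓡 3) ∞ γ I) :
    ContDiffOn ℝ ∞ (fun s => g.inner (γ s) (X (γ s)) (velocity γ s)) I := by
  intro s hs
  refine (contMDiffAt_inner g ?_
    ((contMDiffOn_velocity hI hγ).contMDiffAt (hI.mem_nhds hs))).contDiffWithinAt
  exact (hX.contMDiff_field.contMDiffAt).comp s (hγ.contMDiffAt (hI.mem_nhds hs))

theorem inner_comb (p : N) (V W : TangentSpace (𝓡 3) p) (a b a' b' : ℝ) :
    g.inner p (a • V + b • W) (a' • V + b' • W)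
      = a * a' * g.inner p V V + (a * b' + a' * b) * g.inner p V W + b * b' * g.inner p W W := by
  simp only [map_add, map_smul, add_apply, smul_apply, smul_eq_mul, g.symm p W V]
  ring

section Profile

variable {U : ℝ → ℝ} {m : ℝ} {I : Set ℝ} {γ : ℝ → N} {s₀ : ℝ}

theorem IsProfile.mono (h : IsProfile g X φ U m I γ) {I' : Set ℝ} (hI : I' ⊆ I) :
    IsProfile g X φ U m I' γ :=
  ⟨h.contMDiffOn.mono hI, fun s hs => h.regular s (hI hs), fun s hs => h.volume_eq s (hI hs),
    fun s hs => h.unit_speed s (hI hs)⟩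

theorem IsProfile.inner_field (h : IsProfile g X φ U m I γ) {s : ℝ} (hs : s ∈ I) :
    g.inner (γ s) (X (γ s)) (X (γ s)) = m ^ 2 * U s ^ 2 := by
  rw [← volumeFn_sq, h.volume_eq s hs, mul_pow, sq_abs]

theorem bourTime_contDiffOn (hX : IsKillingFlow g X φ) (hI : IsOpenInterval I)
    (hU : ContDiffOn ℝ ∞ U I) (hUpos : ∀ s ∈ I, 0 < U s) (hm : m ≠ 0)
    (hγ : IsProfile g X φ U m I γ) (hs₀ : s₀ ∈ I) (c : ℝ) :
    ContDiffOn ℝ ∞ (bourTime g X U m γ s₀ c) (I ×ˢ univ) ∧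
      ∀ z ∈ I ×ˢ (univ : Set ℝ), ∀ w : ℝ × ℝ, fderiv ℝ (bourTime g X U m γ s₀ c) z w
        = w.2 / m - w.1 *
          (g.inner (γ z.1) (X (γ z.1)) (velocity γ z.1) / (m ^ 2 * U z.1 ^ 2)) := by
  have hh : ContDiffOn ℝ ∞
      (fun r => g.inner (γ r) (X (γ r)) (velocity γ r) / (m ^ 2 * U r ^ 2)) I :=
    (contDiffOn_inner_velocity hX hI.isOpen hγ.contMDiffOn).div (contDiffOn_const.mul (hU.pow 2))
      (fun s hs => mul_ne_zero (pow_ne_zero 2 hm) (pow_ne_zero 2 (hUpos s hs).ne'))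
  obtain ⟨h1, h2⟩ := contDiffOn_integral hI hh hs₀
  refine ⟨?_, fun z hz w => ?_⟩
  · exact (contDiffOn_const.add (contDiffOn_snd.div_const m)).sub
      (h1.comp contDiffOn_fst fun z hz => hz.1)
  · have h3 := (h2 z.1 hz.1).comp_hasFDerivAt z (hasFDerivAt_fst (𝕜 := ℝ) (E := ℝ) (F := ℝ))
    have h4 : HasFDerivAt (fun z : ℝ × ℝ => c + z.2 / m)
        (m⁻¹ • ContinuousLinearMap.snd ℝ ℝ ℝ) z := by
      simpa only [div_eq_inv_mul] using
        ((hasFDerivAt_snd (𝕜 := ℝ) (E := ℝ) (F := ℝ) (p := z)).const_mul m⁻¹).const_add c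
    have h5 := (h4.sub h3).fderiv
    have h6 : fderiv ℝ (bourTime g X U m γ s₀ c) z = _ := h5
    rw [h6]
    simp [div_eq_mul_inv, mul_comm]

theorem mfderiv_bourMap (hX : IsKillingFlow g X φ) (hI : IsOpenInterval I)
    (hU : ContDiffOn ℝ ∞ U I) (hUpos : ∀ s ∈ I, 0 < U s) (hm : m ≠ 0)
    (hγ : IsProfile g X φ U m I γ) (hs₀ : s₀ ∈ I) (c : ℝ) {z : ℝ × ℝ}
    (hz : z ∈ I ×ˢ (univ : Set ℝ)) (w : ℝ × ℝ) :
    mfderiv 𝓘(ℝ, ℝ × ℝ) (𝓡 3) (bourMap g X φ U m γ s₀ c) z w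
      = mfderiv (𝓡 3) (𝓡 3) (φ (bourTime g X U m γ s₀ c z)) (γ z.1)
        ((w.2 / m - w.1 * (g.inner (γ z.1) (X (γ z.1)) (velocity γ z.1) / (m ^ 2 * U z.1 ^ 2)))
          • X (γ z.1) + w.1 • velocity γ z.1) := by
  obtain ⟨h1, h2⟩ := bourTime_contDiffOn hX hI hU hUpos hm hγ hs₀ c
  have hd : DifferentiableAt ℝ (bourTime g X U m γ s₀ c) z :=
    (h1.contDiffAt ((hI.isOpen.prod isOpen_univ).mem_nhds hz)).differentiableAt (by simp)
  have hγz : MDifferentiableAt 𝓘(ℝ, ℝ) (𝓡 3) γ z.1 :=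
    (hγ.contMDiffOn.contMDiffAt (hI.isOpen.mem_nhds hz.1)).mdifferentiableAt (by simp)
  have hc : MDifferentiableAt 𝓘(ℝ, ℝ × ℝ) (𝓡 3) (fun z : ℝ × ℝ => γ z.1) z :=
    MDifferentiableAt.comp (I' := 𝓘(ℝ, ℝ)) z hγz differentiableAt_fst.mdifferentiableAt
  refine (hX.mfderiv_flow_comp hd hc w).trans ?_
  rw [h2 z hz, mfderiv_comp_fst hγz]

/-- After removing the isometry `dφ_v`, both coordinate vectors are combinations of `X` and `γ'`;
the `s`-derivative of `bourTime` makes the first one orthogonal to `X`. -/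
theorem bourMap_isNatural (hX : IsKillingFlow g X φ) (hI : IsOpenInterval I)
    (hU : ContDiffOn ℝ ∞ U I) (hUpos : ∀ s ∈ I, 0 < U s) (hm : m ≠ 0)
    (hγ : IsProfile g X φ U m I γ) (hs₀ : s₀ ∈ I) (c : ℝ) :
    IsNatural g X U (I ×ˢ univ) (bourMap g X φ U m γ s₀ c) where
  contMDiffOn := by
    obtain ⟨h1, -⟩ := bourTime_contDiffOn hX hI hU hUpos hm hγ hs₀ c
    exact hX.contMDiff.comp_contMDiffOn (h1.contMDiffOn.prodMk
      (hγ.contMDiffOn.comp (f := Prod.fst) contDiff_fst.contMDiff.contMDiffOn fun z hz => hz.1))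
  tangent z hz := by
    refine ⟨1 / m, ?_⟩
    rw [mfderiv_bourMap hX hI hU hUpos hm hγ hs₀ c hz]
    simp only [zero_mul, sub_zero, zero_smul, add_zero, map_smul, hX.mfderiv_field]
    rfl
  metric z hz w w' := by
    have hA : m ^ 2 * U z.1 ^ 2 ≠ 0 :=
      mul_ne_zero (pow_ne_zero 2 hm) (pow_ne_zero 2 (hUpos _ hz.1).ne')
    have h1 := hγ.unit_speed z.1 hz.1
    have h2 := hγ.inner_field hz.1
    rw [orbitNormSq_eq _ _ (by rwa [h2]), h2, g.symm _ (velocity γ z.1) (X (γ z.1))] at h1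
    unfold firstForm
    rw [mfderiv_bourMap hX hI hU hUpos hm hγ hs₀ c hz w,
      mfderiv_bourMap hX hI hU hUpos hm hγ hs₀ c hz w']
    refine (hX.isometry _ _ _ _).trans ((inner_comb _ _ _ _ _ _ _).trans ?_)
    rw [h2]
    have hU0 := (hUpos _ hz.1).ne'
    generalize g.inner (γ z.1) (X (γ z.1)) (velocity γ z.1) = b at *
    generalize g.inner (γ z.1) (velocity γ z.1) (velocity γ z.1) = n at *
    -- Unit speed in the orbit space fixes the full squared speed by Pythagoras; only the component
    -- `b` along `X` stays free, and it cancels.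
    obtain rfl : n = 1 + b ^ 2 / (m ^ 2 * U z.1 ^ 2) := by linarith
    field_simp
    ring

theorem bourMap_isEquivariantImmersion (hX : IsKillingFlow g X φ) (hI : IsOpenInterval I)
    (hU : ContDiffOn ℝ ∞ U I) (hUpos : ∀ s ∈ I, 0 < U s) (hm : m ≠ 0)
    (hγ : IsProfile g X φ U m I γ) (hs₀ : s₀ ∈ I) (c : ℝ) :
    IsEquivariantImmersion (E := ℝ × ℝ) φ (stripAction I hI.isOpen m)
      (fun z : strip I hI.isOpen => bourMap g X φ U m γ s₀ c z) := by
  have hnat := bourMap_isNatural hX hI hU hUpos hm hγ hs₀ c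
  have hsm : ∀ z : strip I hI.isOpen,
      ContMDiffAt 𝓘(ℝ, ℝ × ℝ) (𝓡 3) ∞ (bourMap g X φ U m γ s₀ c) z := fun z =>
    hnat.contMDiffOn.contMDiffAt ((hI.isOpen.prod isOpen_univ).mem_nhds z.2)
  refine ⟨?_, ?_, ?_, ?_, ?_, ?_, ?_⟩
  · rw [← ContMDiff.subtypeVal_comp_iff]
    have h1 : ContMDiff 𝓘(ℝ, ℝ × (ℝ × ℝ)) 𝓘(ℝ, ℝ × ℝ) ∞
        (fun y : ℝ × (ℝ × ℝ) => (y.2.1, y.2.2 + m * y.1)) := by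
      apply ContDiff.contMDiff
      fun_prop
    have h2 : ContMDiff (𝓘(ℝ, ℝ).prod 𝓘(ℝ, ℝ × ℝ)) 𝓘(ℝ, ℝ × (ℝ × ℝ)) ∞
        (fun y : ℝ × strip I hI.isOpen => (y.1, (y.2 : ℝ × ℝ))) :=
      contMDiff_fst.prodMk_space (contMDiff_subtype_val.comp contMDiff_snd)
    exact h1.comp h2
  · intro x
    ext <;> simp [stripAction]
  · intro v v' x
    ext
    · simp [stripAction]
    · simp only [stripAction]
      ring
  · exact fun z => (hsm z).comp z contMDiff_subtype_val.contMDiffAt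
  · intro z
    have h1 := mfderiv_comp (I := 𝓘(ℝ, ℝ × ℝ)) z ((hsm z).mdifferentiableAt (by simp))
      ((contMDiff_subtype_val (n := 1)).mdifferentiable (by simp) z)
    have h2 : Function.Injective
        (mfderiv 𝓘(ℝ, ℝ × ℝ) (𝓡 3) (bourMap g X φ U m γ s₀ c) (z : ℝ × ℝ)) := by
      rw [injective_iff_map_eq_zero]
      intro w hw
      have hU0 := hUpos _ z.2.1
      -- A kernel vector has zero length for the induced metric, which is positive definite because
      -- `U > 0`.
      have h3 : firstForm g (bourMap g X φ U m γ s₀ c) z w w = 0 := by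
        refine (congrArg (fun L => g.inner _ L _) hw).trans ?_
        simp
      have h4 : (0 : ℝ) = w.1 * w.1 + U z.1.1 ^ 2 * (w.2 * w.2) :=
        h3.symm.trans (hnat.metric z z.2 w w)
      have h5 : 0 ≤ U z.1.1 ^ 2 * (w.2 * w.2) := mul_nonneg (sq_nonneg _) (mul_self_nonneg _)
      have h6 := mul_self_nonneg w.1
      have h7 : w.1 * w.1 = 0 := by linarith
      have h8 : U z.1.1 ^ 2 * (w.2 * w.2) = 0 := by linarith
      exact Prod.ext (mul_self_eq_zero.1 h7)
        (mul_self_eq_zero.1 ((mul_eq_zero.1 h8).resolve_left (pow_ne_zero 2 hU0.ne')))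
    have h9 := h2.comp (mfderiv_opens_coe_injective (strip I hI.isOpen) z)
    intro v w hvw
    refine h9 ?_
    have h10 := fun u => congrArg (fun L => L u) h1
    exact (h10 v).symm.trans (hvw.trans (h10 w))
  · exact fun z => hX.flow_mem_regularPart _ (hγ.regular _ z.2.1)
  · intro v z
    simp only [bourMap, stripAction]
    rw [← hX.map_add]
    congr 1
    simp only [bourTime]
    field_simp
    ring

end Profile

end

/-! ### Every surface in natural parameters comes from a profile -/

section

variable {N : Type*} [TopologicalSpace N] [ChartedSpace E3 N] [IsManifold (𝓡 3) ∞ N]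
  {g : Metric N} {X : (p : N) → TangentSpace (𝓡 3) p} {φ : ℝ → N → N}

theorem IsKillingFlow.mdifferentiable_inner_field (hX : IsKillingFlow g X φ) :
    MDifferentiable (𝓡 3) 𝓘(ℝ, ℝ) (fun p => g.inner p (X p) (X p)) := by
  let _ : Bundle.RiemannianBundle (fun p : N => TangentSpace (𝓡 3) p) := ⟨g.toRiemannianMetric⟩
  exact (ContMDiff.inner_bundle (IB := 𝓡 3) (n := ∞) (F := E3) hX.contMDiff_field
    hX.contMDiff_field).mdifferentiable (by simp)

theorem IsKillingFlow.mfderiv_inner_field (hX : IsKillingFlow g X φ) (p : N) :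
    mfderiv (𝓡 3) 𝓘(ℝ, ℝ) (fun p => g.inner p (X p) (X p)) p (X p) = (0 : ℝ) := by
  have h1 := mfderiv_comp_apply (0 : ℝ) (hX.mdifferentiable_inner_field (φ 0 p))
    (hX.integralCurve p 0).mdifferentiableAt (1 : ℝ)
  have h2 : ((fun p => g.inner p (X p) (X p)) ∘ fun t => φ t p)
      = fun _ => g.inner p (X p) (X p) := by
    ext t
    exact hX.inner_field_flow t p
  have h3 := hX.mfderiv_time 0 p 1
  rw [one_smul] at h3
  rw [h2, mfderiv_const, h3, hX.map_zero] at h1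
  exact h1.symm

theorem IsKillingFlow.hasDerivAt_inner_field (hX : IsKillingFlow g X φ) {c : ℝ → N} {t k : ℝ}
    (hc : HasMFDerivAt 𝓘(ℝ, ℝ) (𝓡 3) c t ((1 : ℝ →L[ℝ] ℝ).smulRight (k • X (c t)))) :
    HasDerivAt (fun t => g.inner (c t) (X (c t)) (X (c t))) 0 t := by
  have h1 := (hX.mdifferentiable_inner_field (c t)).hasMFDerivAt.comp t hc
  let L : E3 →L[ℝ] ℝ := mfderiv (𝓡 3) 𝓘(ℝ, ℝ) (fun p => g.inner p (X p) (X p)) (c t)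
  have h2 : HasFDerivAt (fun t => g.inner (c t) (X (c t)) (X (c t)))
      (L.comp ((1 : ℝ →L[ℝ] ℝ).smulRight (k • X (c t) : E3))) t := h1.hasFDerivAt
  have h3 : L (X (c t)) = 0 := hX.mfderiv_inner_field (c t)
  have h4 : L (k • X (c t) : E3) = 0 := by
    refine (L.map_smul k (X (c t))).trans ?_
    rw [h3, smul_zero]
  have h5 := h2.hasDerivAt
  have h6 : (L.comp ((1 : ℝ →L[ℝ] ℝ).smulRight (k • X (c t) : E3))) 1 = 0 :=
    (congrArg L (one_smul ℝ (k • X (c t)))).trans h4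
  rwa [h6] at h5

/-- Both sides are integral curves of `k • X` that agree at `t₀`, and integral curves in a Hausdorff
manifold are unique. -/
theorem IsKillingFlow.eq_flow_of_mfderiv [T2Space N] (hX : IsKillingFlow g X φ) {c : ℝ → N}
    {J : Set ℝ} (hJ : IsOpenInterval J) {k : ℝ}
    (hc : ∀ t ∈ J, HasMFDerivAt 𝓘(ℝ, ℝ) (𝓡 3) c t
      ((1 : ℝ →L[ℝ] ℝ).smulRight (k • X (c t)))) {t₀ t : ℝ} (ht₀ : t₀ ∈ J) (ht : t ∈ J) :
    c t = φ (k * (t - t₀)) (c t₀) := by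
  -- Uniqueness is applied on a bounded open interval, so one inside `J` containing both times is
  -- needed.
  obtain ⟨a, b, ha, hb, hJab⟩ : ∃ a b, t₀ ∈ Ioo a b ∧ t ∈ Ioo a b ∧ Ioo a b ⊆ J := by
    obtain ⟨l, r, hlr, hlr'⟩ := mem_nhds_iff_exists_Ioo_subset.1
      (hJ.isOpen.mem_nhds (show min t₀ t ∈ J by rcases min_choice t₀ t with h | h <;> rwa [h]))
    obtain ⟨l', r', hlr₂, hlr₂'⟩ := mem_nhds_iff_exists_Ioo_subset.1
      (hJ.isOpen.mem_nhds (show max t₀ t ∈ J by rcases max_choice t₀ t with h | h <;> rwa [h]))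
    refine ⟨l, r', ⟨hlr.1.trans_le (min_le_left _ _), (le_max_left _ _).trans_lt hlr₂.2⟩,
      ⟨hlr.1.trans_le (min_le_right _ _), (le_max_right _ _).trans_lt hlr₂.2⟩, ?_⟩
    intro x hx
    by_cases h1 : x < r
    · exact hlr' ⟨hx.1, h1⟩
    by_cases h2 : l' < x
    · exact hlr₂' ⟨h2, hx.2⟩
    have := hJ.ordConnected
    exact this.out (show min t₀ t ∈ J by rcases min_choice t₀ t with h | h <;> rwa [h])
      (show max t₀ t ∈ J by rcases max_choice t₀ t with h | h <;> rwa [h])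
      ⟨hlr.2.le.trans (not_lt.1 h1), (not_lt.1 h2).trans hlr₂.1.le⟩
  have hflow : ∀ q t, HasMFDerivAt 𝓘(ℝ, ℝ) (𝓡 3) (fun t => φ (k * (t - t₀)) q) t
      ((1 : ℝ →L[ℝ] ℝ).smulRight (k • X (φ (k * (t - t₀)) q))) := by
    intro q t
    have h1 : HasDerivAt (fun t => k * (t - t₀)) k t := by
      simpa using ((hasDerivAt_id t).sub_const t₀).const_mul k
    have h2 := (hX.integralCurve q (k * (t - t₀))).comp t h1.hasFDerivAt.hasMFDerivAt
    have h3 : ((1 : ℝ →L[ℝ] ℝ).smulRight (k • X (φ (k * (t - t₀)) q)))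
        = ((1 : ℝ →L[ℝ] ℝ).smulRight (X (φ (k * (t - t₀)) q))).comp
          (ContinuousLinearMap.toSpanSingleton ℝ k) := by
      ext
      simp
    rw [h3]
    exact h2
  have hv : ContMDiff (𝓡 3) (𝓡 3).tangent 1 (fun p => (⟨p, k • X p⟩ : TangentBundle (𝓡 3) N)) :=
    ((hX.contMDiff_field.const_smul_section (a := k)).of_le (by simp))
  have := isMIntegralCurveOn_Ioo_eqOn_of_contMDiff_boundaryless (γ := c)
    (γ' := fun t => φ (k * (t - t₀)) (c t₀)) (v := fun p => k • X p) ha hv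
    (fun t ht => (hc t (hJab ht)).hasMFDerivWithinAt)
    (fun t ht => (hflow (c t₀) t).hasMFDerivWithinAt) (by simp [hX.map_zero])
  exact this hb

theorem firstForm_congr {F G : ℝ × ℝ → N} {z : ℝ × ℝ} (h : F =ᶠ[𝓝 z] G) {w w' : ℝ × ℝ} :
    firstForm g F z w w' = firstForm g G z w w' := by
  unfold firstForm
  rw [h.mfderiv_eq]
  exact congrArg (fun p => (g.inner p : E3 →L[ℝ] E3 →L[ℝ] ℝ)
    (mfderiv 𝓘(ℝ, ℝ × ℝ) (𝓡 3) G z w) (mfderiv 𝓘(ℝ, ℝ × ℝ) (𝓡 3) G z w')) h.eq_of_nhds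

/-- The profile is a coordinate line `t = t₀`, and `m⁻¹` is the factor between `∂_t F` and `X`; the
work lies in showing that this factor is constant. It is recorded in the conclusion in order to
settle when `m = 1`. -/
theorem exists_profile_of_isNatural [T2Space N] (hX : IsKillingFlow g X φ) {U : ℝ → ℝ}
    {I J : Set ℝ} (hI : IsOpenInterval I) (hJ : IsOpenInterval J)
    (hUpos : ∀ s ∈ I, 0 < U s) {F : ℝ × ℝ → N} (hreg : ∀ z ∈ I ×ˢ J, F z ∈ regularPart φ)
    (hF : IsNatural g X U (I ×ˢ J) F) :
    ∃ m : ℝ, m ≠ 0 ∧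
      (∀ z ∈ I ×ˢ J, mfderiv 𝓘(ℝ, ℝ × ℝ) (𝓡 3) F z ((0, 1) : ℝ × ℝ) = m⁻¹ • X (F z)) ∧
      ∃ γ : ℝ → N, IsProfile g X φ U m I γ ∧
        ∃ s₀ ∈ I, ∃ c : ℝ, ∀ z ∈ I ×ˢ J, F z = bourMap g X φ U m γ s₀ c z := by
  obtain ⟨t₀, ht₀⟩ := hJ.nonempty
  obtain ⟨s₀, hs₀⟩ := hI.nonempty
  have hR : IsOpen (I ×ˢ J) := hI.isOpen.prod hJ.isOpen
  have hFs : ∀ z ∈ I ×ˢ J, ContMDiffAt 𝓘(ℝ, ℝ × ℝ) (𝓡 3) ∞ F z := fun z hz =>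
    hF.contMDiffOn.contMDiffAt (hR.mem_nhds hz)
  have hFd : ∀ z ∈ I ×ˢ J, MDifferentiableAt 𝓘(ℝ, ℝ × ℝ) (𝓡 3) F z := fun z hz =>
    (hFs z hz).mdifferentiableAt (by simp)
  set A : ℝ × ℝ → ℝ := fun z => g.inner (F z) (X (F z)) (X (F z)) with hA
  set D : (z : ℝ × ℝ) → TangentSpace (𝓡 3) (F z) := fun z =>
    mfderiv 𝓘(ℝ, ℝ × ℝ) (𝓡 3) F z ((0, 1) : ℝ × ℝ) with hD
  have hDs : ∀ z ∈ I ×ˢ J, ContMDiffAt 𝓘(ℝ, ℝ × ℝ) (𝓡 3).tangent ∞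
      (fun z => (⟨F z, D z⟩ : TangentBundle (𝓡 3) N)) z := by
    refine fun z hz => ContMDiffOn.contMDiffAt ?_ (hR.mem_nhds hz)
    exact (contMDiffOn_mfderiv hR hF.contMDiffOn).comp
      (f := fun z : ℝ × ℝ => (z, ((0, 1) : ℝ × ℝ)))
      (contDiff_id.prodMk contDiff_const).contMDiff.contMDiffOn (fun _ hs => ⟨hs, mem_univ _⟩)
  have hXs : ∀ z ∈ I ×ˢ J, ContMDiffAt 𝓘(ℝ, ℝ × ℝ) (𝓡 3).tangent ∞
      (fun z => (⟨F z, X (F z)⟩ : TangentBundle (𝓡 3) N)) z := fun z hz =>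
    hX.contMDiff_field.contMDiffAt.comp z (hFs z hz)
  -- The factors supplied by `tangent` are chosen pointwise; this formula recovers them as a smooth
  -- function.
  set k : ℝ × ℝ → ℝ := fun z => g.inner (F z) (D z) (X (F z)) / A z with hk
  have hnorm : ∀ z ∈ I ×ˢ J, g.inner (F z) (D z) (D z) = U z.1 ^ 2 := by
    intro z hz
    have := hF.metric z hz (0, 1) (0, 1)
    simpa [firstForm] using this
  have hApos : ∀ z ∈ I ×ˢ J, A z ≠ 0 ∧ D z = k z • X (F z) := by
    intro z hz
    obtain ⟨κ, hκ⟩ := hF.tangent z hz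
    have hκ' : D z = κ • X (F z) := hκ
    have h1 := hnorm z hz
    rw [hκ'] at h1
    simp only [map_smul, smul_apply, smul_eq_mul] at h1
    have h2 : A z ≠ 0 := by
      intro h
      rw [hA] at h
      simp only at h
      rw [h] at h1
      have := pow_ne_zero 2 (hUpos _ hz.1).ne'
      simp at h1
      exact this (by simpa using h1.symm)
    refine ⟨h2, ?_⟩
    have h3 : k z = κ := by
      simp only [hk, hκ', map_smul, smul_apply, smul_eq_mul]
      rw [hA] at h2 ⊢
      simp only at h2 ⊢
      field_simp
    rw [h3, hκ']
  have hksq : ∀ z ∈ I ×ˢ J, k z ^ 2 * A z = U z.1 ^ 2 := by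
    intro z hz
    rw [← hnorm z hz, (hApos z hz).2]
    simp only [map_smul, smul_apply, smul_eq_mul, hA]
    ring
  have hkne : ∀ z ∈ I ×ˢ J, k z ≠ 0 := by
    intro z hz h
    have := hksq z hz
    rw [h] at this
    have h2 := pow_ne_zero 2 (hUpos _ hz.1).ne'
    exact h2 (by rw [← this]; ring)
  have hks : ∀ z ∈ I ×ˢ J, ContDiffAt ℝ ∞ k z := fun z hz =>
    (contMDiffAt_inner g (hDs z hz) (hXs z hz)).div
      (contMDiffAt_inner g (hXs z hz) (hXs z hz)) (hApos z hz).1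
  have hcurve : ∀ s ∈ I, ∀ t ∈ J, HasMFDerivAt 𝓘(ℝ, ℝ) (𝓡 3) (fun t => F (s, t)) t
      ((1 : ℝ →L[ℝ] ℝ).smulRight (D (s, t))) := by
    intro s hs t ht
    have h1 : HasFDerivAt (fun t : ℝ => (s, t)) (ContinuousLinearMap.inr ℝ ℝ ℝ) t :=
      hasFDerivAt_prodMk_right s t
    have h2 := (hFd (s, t) ⟨hs, ht⟩).hasMFDerivAt.comp t h1.hasMFDerivAt
    have h3 : ((1 : ℝ →L[ℝ] ℝ).smulRight (D (s, t))) =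
        (mfderiv 𝓘(ℝ, ℝ × ℝ) (𝓡 3) F (s, t)).comp (ContinuousLinearMap.inr ℝ ℝ ℝ) := by
      ext1
      exact one_smul ℝ (D (s, t))
    rw [h3]
    exact h2
  have hAt : ∀ s ∈ I, ∀ t ∈ J, HasDerivAt (fun t => A (s, t)) 0 t := by
    intro s hs t ht
    have h1 := hcurve s hs t ht
    rw [(hApos _ ⟨hs, ht⟩).2] at h1
    exact hX.hasDerivAt_inner_field h1
  have hAc : ∀ s ∈ I, ∀ t ∈ J, A (s, t) = A (s, t₀) := fun s hs t ht =>
    hJ.isOpen.is_const_of_deriv_eq_zero (f := fun t => A (s, t)) hJ.ordConnected.isPreconnected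
      (fun t ht => (hAt s hs t ht).differentiableAt.differentiableWithinAt)
      (fun t ht => (hAt s hs t ht).deriv) ht ht₀
  -- Only `k²` is known to be independent of `t`; continuity and the absence of zeros on the
  -- connected `J` exclude a change of sign.
  have hkt : ∀ s ∈ I, ∀ t ∈ J, k (s, t) = k (s, t₀) := by
    intro s hs
    have h1 : ContinuousOn (fun t => k (s, t)) J := fun t ht =>
      ((hks (s, t) ⟨hs, ht⟩).continuousAt.comp (f := fun t => (s, t))
        (by fun_prop)).continuousWithinAt
    have h2 : EqOn ((fun t => k (s, t)) ^ 2) ((fun _ => k (s, t₀)) ^ 2) J := by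
      intro t ht
      have h3 := hksq (s, t) ⟨hs, ht⟩
      rw [hAc s hs t ht, ← hksq (s, t₀) ⟨hs, ht₀⟩] at h3
      exact mul_right_cancel₀ (hApos (s, t₀) ⟨hs, ht₀⟩).1 h3
    exact fun t ht => hJ.ordConnected.isPreconnected.eq_of_sq_eq h1 continuousOn_const h2
      (fun _ => hkne (s, t₀) ⟨hs, ht₀⟩) ht₀ rfl ht
  set κ : ℝ → ℝ := fun s => k (s, t₀) with hκ
  set γ : ℝ → N := fun s => F (s, t₀) with hγ
  have hFφ : ∀ z ∈ I ×ˢ J, F z = φ (κ z.1 * (z.2 - t₀)) (γ z.1) := by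
    rintro ⟨s, t⟩ ⟨hs, ht⟩
    refine hX.eq_flow_of_mfderiv (c := fun t => F (s, t)) hJ (fun t ht => ?_) ht₀ ht
    have h1 := hcurve s hs t ht
    rwa [(hApos (s, t) ⟨hs, ht⟩).2, hkt s hs t ht] at h1
  have hκd : ∀ s ∈ I, DifferentiableAt ℝ κ s := fun s hs =>
    DifferentiableAt.comp (f := fun s => (s, t₀)) s
      ((hks (s, t₀) ⟨hs, ht₀⟩).differentiableAt (by simp)) (by fun_prop)
  have hγs : ContMDiffOn 𝓘(ℝ, ℝ) (𝓡 3) ∞ γ I := hF.contMDiffOn.comp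
    (f := fun s : ℝ => (s, t₀)) (contDiff_id.prodMk contDiff_const).contMDiff.contMDiffOn
    (fun s hs => ⟨hs, ht₀⟩)
  have hvel : ∀ s ∈ I, velocity γ s = mfderiv 𝓘(ℝ, ℝ × ℝ) (𝓡 3) F (s, t₀) ((1, 0) : ℝ × ℝ) := by
    intro s hs
    have h1 : HasFDerivAt (fun s : ℝ => (s, t₀)) (ContinuousLinearMap.inl ℝ ℝ ℝ) s :=
      hasFDerivAt_prodMk_left s t₀
    have h2 := (hFd (s, t₀) ⟨hs, ht₀⟩).hasMFDerivAt.comp s h1.hasMFDerivAt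
    rw [velocity]
    exact congrArg (fun L => L (1 : ℝ)) h2.mfderiv
  have horth : ∀ s ∈ I, g.inner (γ s) (velocity γ s) (X (γ s)) = 0 := by
    intro s hs
    have h1 := hF.metric (s, t₀) ⟨hs, ht₀⟩ (1, 0) (0, 1)
    have h2 : g.inner (γ s) (velocity γ s) (D (s, t₀)) = 0 := by
      rw [hvel s hs]
      refine h1.trans (by simp)
    rw [(hApos _ ⟨hs, ht₀⟩).2, map_smul, smul_eq_mul] at h2
    exact (mul_eq_zero.1 h2).resolve_left (hkne _ ⟨hs, ht₀⟩)
  -- At some `t ≠ t₀`, the mixed coefficient of the metric equals `(t - t₀) κ' κ ‖X‖²`, because `γ'`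
  -- is orthogonal to `X`; it must vanish.
  have hκ0 : ∀ s ∈ I, deriv κ s = 0 := by
    intro s hs
    obtain ⟨t, ht, htt⟩ : ∃ t ∈ J, t ≠ t₀ := by
      obtain ⟨ε, hε, hball⟩ := Metric.isOpen_iff.1 hJ.isOpen t₀ ht₀
      refine ⟨t₀ + ε / 2, hball ?_, by linarith⟩
      rw [Metric.mem_ball, Real.dist_eq]
      rw [abs_lt]
      constructor <;> linarith
    have hz : (s, t) ∈ I ×ˢ J := ⟨hs, ht⟩
    have h1 := hF.metric (s, t) hz (1, 0) (0, 1)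
    have h2 : F =ᶠ[𝓝 (s, t)] fun z => φ (κ z.1 * (z.2 - t₀)) (γ z.1) :=
      Filter.eventually_of_mem (hR.mem_nhds hz) hFφ
    rw [firstForm_congr h2] at h1
    have h3 : HasFDerivAt (fun z : ℝ × ℝ => κ z.1 * (z.2 - t₀))
        (κ s • ContinuousLinearMap.snd ℝ ℝ ℝ +
          (t - t₀) • (deriv κ s • ContinuousLinearMap.fst ℝ ℝ ℝ)) (s, t) := by
      have h4 := (hκd s hs).hasDerivAt.comp_hasFDerivAt (s, t)
        (hasFDerivAt_fst (𝕜 := ℝ) (E := ℝ) (F := ℝ) (p := (s, t)))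
      exact h4.mul ((hasFDerivAt_snd (𝕜 := ℝ) (E := ℝ) (F := ℝ) (p := (s, t))).sub_const t₀)
    have hγz : MDifferentiableAt 𝓘(ℝ, ℝ) (𝓡 3) γ s :=
      (hγs.contMDiffAt (hI.isOpen.mem_nhds hs)).mdifferentiableAt (by simp)
    have hc : MDifferentiableAt 𝓘(ℝ, ℝ × ℝ) (𝓡 3) (fun z : ℝ × ℝ => γ z.1) (s, t) :=
      MDifferentiableAt.comp (g := γ) (f := Prod.fst) (I' := 𝓘(ℝ, ℝ)) (s, t) hγz
        differentiableAt_fst.mdifferentiableAt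
    have h5 := fun w => hX.mfderiv_flow_comp h3.differentiableAt hc w
    unfold firstForm at h1
    rw [h5 (1, 0), h5 (0, 1), h3.fderiv, mfderiv_comp_fst hγz, mfderiv_comp_fst hγz] at h1
    have h6 := (hX.isometry _ _ _ _).symm.trans h1
    have horth' : g.inner (γ s) (X (γ s)) (velocity γ s) = 0 :=
      (g.symm _ _ _).trans (horth s hs)
    rw [inner_comb] at h6
    dsimp only at h6
    rw [horth'] at h6
    have h7 : A (s, t₀) ≠ 0 := (hApos _ ⟨hs, ht₀⟩).1
    have h8 : κ s ≠ 0 := hkne _ ⟨hs, ht₀⟩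
    have h9 : (t - t₀) * deriv κ s * κ s * A (s, t₀) = 0 := by
      have h10 : g.inner (γ s) (X (γ s)) (X (γ s)) = A (s, t₀) := rfl
      rw [h10] at h6
      simpa using h6
    simpa [h7, h8, sub_ne_zero.2 htt] using h9
  have hκc : ∀ s ∈ I, κ s = κ s₀ := fun s hs =>
    hI.isOpen.is_const_of_deriv_eq_zero hI.ordConnected.isPreconnected
      (fun s hs => (hκd s hs).differentiableWithinAt) hκ0 hs hs₀
  have hκne : κ s₀ ≠ 0 := hkne _ ⟨hs₀, ht₀⟩
  -- The integral in `bourTime` vanishes since `γ' ⊥ X`, so `v = κ(t - t₀)` dictates `m = 1/κ` and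
  -- `c = -κ t₀`.
  refine ⟨(κ s₀)⁻¹, inv_ne_zero hκne, fun z hz => ?_, γ, ⟨hγs, fun s hs => hreg _ ⟨hs, ht₀⟩,
    fun s hs => ?_, fun s hs => ?_⟩, s₀, hs₀, -(κ s₀ * t₀), fun z hz => ?_⟩
  · rw [inv_inv, ← hκc z.1 hz.1]
    refine (hApos z hz).2.trans ?_
    exact congrArg (· • X (F z)) (hkt z.1 hz.1 z.2 hz.2)
  · have h1 := hksq (s, t₀) ⟨hs, ht₀⟩
    have h2 : k (s, t₀) = κ s₀ := hκc s hs
    rw [h2] at h1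
    have h3 : A (s, t₀) = ((|κ s₀|)⁻¹ * U s) ^ 2 := by
      rw [mul_pow, ← h1, inv_pow, sq_abs, inv_mul_cancel_left₀ (pow_ne_zero 2 hκne)]
    rw [volumeFn, abs_inv]
    exact (congrArg Real.sqrt h3).trans
      (Real.sqrt_sq (mul_nonneg (inv_nonneg.2 (abs_nonneg _)) (hUpos s hs).le))
  · rw [orbitNormSq_eq _ _ (hApos (s, t₀) ⟨hs, ht₀⟩).1, horth s hs, hvel s hs]
    have h1 := hF.metric (s, t₀) ⟨hs, ht₀⟩ (1, 0) (1, 0)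
    have h2 : g.inner (γ s) (mfderiv 𝓘(ℝ, ℝ × ℝ) (𝓡 3) F (s, t₀) ((1, 0) : ℝ × ℝ))
      (mfderiv 𝓘(ℝ, ℝ × ℝ) (𝓡 3) F (s, t₀) ((1, 0) : ℝ × ℝ)) = 1 := h1.trans (by simp)
    rw [h2]
    simp
  · rw [hFφ z hz, hκc z.1 hz.1, bourMap]
    congr 1
    have h1 : ∫ r in s₀..z.1, g.inner (γ r) (X (γ r)) (velocity γ r) /
        ((κ s₀)⁻¹ ^ 2 * U r ^ 2) = ∫ r in s₀..z.1, (0 : ℝ) := by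
      refine intervalIntegral.integral_congr fun r hr => ?_
      have := hI.ordConnected
      have hr' : r ∈ I := OrdConnected.uIcc_subset this hs₀ hz.1 hr
      simp only [g.symm _ (X (γ r)), horth r hr', zero_div]
    rw [bourTime, h1, intervalIntegral.integral_zero]
    field_simp
    ring

end

/-! ### Implicit functions and ODEs with a parameter -/

section

/-- `ContDiffAt ℝ ∞` at `x₀` does not by itself give `ContDiffAt ℝ ∞` at nearby points. The implicit
function is therefore built again at each nearby point, where invertibility persists, and local
uniqueness identifies it with `ψ`. -/
theorem exists_implicit {E₁ E₂ F : Type*} [NormedAddCommGroup E₁] [NormedSpace ℝ E₁]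
    [CompleteSpace E₁] [NormedAddCommGroup E₂] [NormedSpace ℝ E₂] [CompleteSpace E₂]
    [NormedAddCommGroup F] [NormedSpace ℝ F] [CompleteSpace F]
    {f : E₁ × E₂ → F} {x₀ : E₁} {y₀ : E₂} (hf : ∀ᶠ v in 𝓝 (x₀, y₀), ContDiffAt ℝ ∞ f v)
    (hinv : (fderiv ℝ f (x₀, y₀) ∘L .inr ℝ E₁ E₂).IsInvertible) (h0 : f (x₀, y₀) = 0) :
    ∃ ψ : E₁ → E₂, ψ x₀ = y₀ ∧ (∀ᶠ x in 𝓝 x₀, ContDiffAt ℝ ∞ ψ x) ∧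
      (∀ᶠ x in 𝓝 x₀, f (x, ψ x) = 0) ∧ ∀ᶠ v in 𝓝 (x₀, y₀), f v = 0 → ψ v.1 = v.2 := by
  have hf₀ := hf.self_of_nhds
  let ψ := hf₀.implicitFunction (by simp) hinv
  have hψ₀ : ψ x₀ = y₀ := hf₀.implicitFunction_apply_self (by simp) hinv
  have hψc : ContDiffAt ℝ ∞ ψ x₀ := hf₀.contDiffAt_implicitFunction (by simp) hinv
  have hev : ∀ᶠ v in 𝓝 (x₀, y₀), f v = 0 ↔ ψ v.1 = v.2 := by
    simpa only [h0] using hf₀.eventually_apply_eq_iff_implicitFunction (by simp) hinv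
  have hz : ∀ᶠ x in 𝓝 x₀, f (x, ψ x) = 0 := by
    simpa only [h0] using hf₀.eventually_apply_implicitFunction (by simp) hinv
  have hinv' : ∀ᶠ v in 𝓝 (x₀, y₀), (fderiv ℝ f v ∘L .inr ℝ E₁ E₂).IsInvertible := by
    have h1 : ContinuousAt (fun v => fderiv ℝ f v ∘L .inr ℝ E₁ E₂) (x₀, y₀) :=
      (hf₀.continuousAt_fderiv (by simp)).clm_comp continuousAt_const
    exact h1.eventually (ContinuousLinearEquiv.isOpen.mem_nhds hinv)
  have hlift : Tendsto (fun x => (x, ψ x)) (𝓝 x₀) (𝓝 (x₀, y₀)) := by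
    have h1 : ContinuousAt (fun x => (x, ψ x)) x₀ := continuousAt_id.prodMk hψc.continuousAt
    rwa [ContinuousAt, hψ₀] at h1
  refine ⟨ψ, hψ₀, ?_, hz, hev.mono fun v hv => hv.1⟩
  filter_upwards [hlift.eventually hf, hlift.eventually hinv', hz,
    hlift.eventually (eventually_eventually_nhds.2 hev)] with x hfx hix hzx hex
  let ψ' := hfx.implicitFunction (by simp) hix
  have h1 : ψ' x = ψ x := hfx.implicitFunction_apply_self (by simp) hix
  have h2 : ContDiffAt ℝ ∞ ψ' x := hfx.contDiffAt_implicitFunction (by simp) hix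
  have h3 : ∀ᶠ x' in 𝓝 x, f (x', ψ' x') = 0 := by
    simpa only [hzx] using hfx.eventually_apply_implicitFunction (by simp) hix
  have h4 : Tendsto (fun x' => (x', ψ' x')) (𝓝 x) (𝓝 (x, ψ x)) := by
    have h5 : ContinuousAt (fun x => (x, ψ' x)) x := continuousAt_id.prodMk h2.continuousAt
    rwa [ContinuousAt, h1] at h5
  refine h2.congr_of_eventuallyEq ?_
  filter_upwards [h3, h4.eventually hex] with x' h6 h7
  exact h7.1 h6

/-- Bootstrapping: a `C^n` solution has a `C^n` right-hand side, hence is `C^(n+1)`. -/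
theorem contDiffOn_of_ode {E : Type*} [NormedAddCommGroup E] [NormedSpace ℝ E] {I : Set ℝ}
    (hI : IsOpen I) {V : ℝ × E → E} {c : ℝ → E} (hV : ∀ s ∈ I, ContDiffAt ℝ ∞ V (s, c s))
    (hc : ∀ s ∈ I, HasDerivAt c (V (s, c s)) s) : ContDiffOn ℝ ∞ c I := by
  rw [contDiffOn_infty]
  intro n
  induction n with
  | zero => exact contDiffOn_zero.2 fun s hs => (hc s hs).continuousAt.continuousWithinAt
  | succ n ih =>
    push_cast
    rw [contDiffOn_succ_iff_deriv_of_isOpen hI]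
    refine ⟨fun s hs => (hc s hs).differentiableAt.differentiableWithinAt, by simp, ?_⟩
    refine ContDiffOn.congr (f := fun s => V (s, c s)) (fun s hs => ?_)
      fun s hs => (hc s hs).deriv
    exact ((hV s hs).of_le (by exact_mod_cast le_top)).comp_contDiffWithinAt s
      (contDiffWithinAt_id.prodMk (ih s hs))

/-- Supplies initial points for the ODE: on the line through `q₀` in a direction `w` transverse to
the level set, `W = μ a` is solved for the position. -/
theorem exists_level_curve {E : Type*} [NormedAddCommGroup E] [NormedSpace ℝ E]
    {W : E → ℝ} {q₀ w : E} (hW : ∀ᶠ q in 𝓝 q₀, ContDiffAt ℝ ∞ W q)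
    (hw : fderiv ℝ W q₀ w ≠ 0) {a μ₀ : ℝ} (h0 : W q₀ = μ₀ * a) :
    ∃ P : ℝ → E, P μ₀ = q₀ ∧ (∀ᶠ μ in 𝓝 μ₀, ContinuousAt P μ) ∧
      ∀ᶠ μ in 𝓝 μ₀, W (P μ) = μ * a := by
  let f : ℝ × ℝ → ℝ := fun y => W (q₀ + y.2 • w) - y.1 * a
  have t1 : Tendsto (fun y : ℝ × ℝ => q₀ + y.2 • w) (𝓝 (μ₀, 0)) (𝓝 q₀) := by
    have : Tendsto (fun y : ℝ × ℝ => q₀ + y.2 • w) (𝓝 (μ₀, 0)) (𝓝 (q₀ + (0 : ℝ) • w)) :=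
      Continuous.tendsto (by fun_prop) _
    simpa using this
  have hf : ∀ᶠ y in 𝓝 (μ₀, (0 : ℝ)), ContDiffAt ℝ ∞ f y := by
    filter_upwards [t1.eventually hW] with y hy
    exact (ContDiffAt.comp (g := W) (f := fun y : ℝ × ℝ => q₀ + y.2 • w) y hy
      (by fun_prop)).sub (by fun_prop)
  have hinv : (fderiv ℝ f (μ₀, 0) ∘L .inr ℝ ℝ ℝ).IsInvertible := by
    have d1 := (hf.self_of_nhds.differentiableAt (by simp)).hasFDerivAt.comp (0 : ℝ)
      (hasFDerivAt_prodMk_right (𝕜 := ℝ) μ₀ (0 : ℝ))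
    have d2 : HasFDerivAt (fun y : ℝ => q₀ + y • w)
        ((ContinuousLinearMap.id ℝ ℝ).smulRight w) 0 :=
      ((hasFDerivAt_id (𝕜 := ℝ) (0 : ℝ)).smul_const w).const_add q₀
    have d3 : HasFDerivAt W (fderiv ℝ W q₀) (q₀ + (0 : ℝ) • w) := by
      rw [zero_smul, add_zero]
      exact (hW.self_of_nhds.differentiableAt (by simp)).hasFDerivAt
    rw [d1.unique ((d3.comp (0 : ℝ) d2).sub_const (μ₀ * a))]
    refine ⟨ContinuousLinearEquiv.unitsEquivAut ℝ (Units.mk0 _ hw), ?_⟩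
    ext
    simp
  obtain ⟨ψ, hψ₀, hψs, hψf, -⟩ := exists_implicit hf hinv (by simp [f, h0])
  refine ⟨fun μ => q₀ + ψ μ • w, by simp [hψ₀], ?_, ?_⟩
  · filter_upwards [hψs] with μ hμ
    exact continuousAt_const.add (hμ.continuousAt.smul continuousAt_const)
  · filter_upwards [hψf] with μ hμ
    exact sub_eq_zero.1 hμ

section Family

variable {E : Type*} [NormedAddCommGroup E] [NormedSpace ℝ E] [CompleteSpace E]

theorem exists_flow_family {V : ℝ × ℝ × E → E} {μ₀ s₁ : ℝ} {q₀ : E}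
    (hV : ContDiffAt ℝ 1 V (μ₀, s₁, q₀)) {P : ℝ → E} (hP : ∀ᶠ μ in 𝓝 μ₀, ContinuousAt P μ)
    (hP₀ : P μ₀ = q₀) {O : Set (ℝ × ℝ × E)} (hO : O ∈ 𝓝 (μ₀, s₁, q₀)) :
    ∃ ε > 0, ∃ δ > 0, ∃ c : ℝ → ℝ → E,
      ContinuousOn (fun q : ℝ × ℝ => c q.1 q.2)
        (Ioo (μ₀ - ε) (μ₀ + ε) ×ˢ Ioo (s₁ - δ) (s₁ + δ)) ∧
      ∀ μ ∈ Ioo (μ₀ - ε) (μ₀ + ε), c μ s₁ = P μ ∧ ∀ s ∈ Ioo (s₁ - δ) (s₁ + δ),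
        (μ, s, c μ s) ∈ O ∧ HasDerivAt (c μ) (V (μ, s, c μ s)) s := by
  -- Parameter and time become state variables, so continuous dependence on initial values also
  -- gives dependence on the parameter.
  let Y : ℝ × ℝ × E → ℝ × ℝ × E := fun z => (0, 1, V z)
  have hY : ContDiffAt ℝ 1 Y (μ₀, s₁, q₀) :=
    contDiffAt_const.prodMk (contDiffAt_const.prodMk hV)
  obtain ⟨η, hη, a, r, L, K, hr, hPL⟩ := IsPicardLindelof.of_contDiffAt_one hY
  obtain ⟨α, hα, hαc⟩ := (hPL s₁).exists_forall_mem_closedBall_eq_hasDerivWithinAt_continuousOn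
  have hr' : (0 : ℝ) < r := hr
  -- the solutions keep the parameter fixed and run through time at unit speed
  have hcomp : ∀ z ∈ Metric.closedBall (μ₀, s₁, q₀) (r : ℝ), z.2.1 = s₁ →
      ∀ t ∈ Ioo (s₁ - η) (s₁ + η), HasDerivAt (fun t => α (z, t)) (Y (α (z, t))) t ∧
        (α (z, t)).1 = z.1 ∧ (α (z, t)).2.1 = t := by
    intro z hz hz1
    have hd : ∀ t ∈ Ioo (s₁ - η) (s₁ + η), HasDerivAt (fun t => α (z, t)) (Y (α (z, t))) t :=
      fun t ht => ((hα z hz).2 t (Ioo_subset_Icc_self ht)).hasDerivAt (Icc_mem_nhds ht.1 ht.2)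
    have hs₁ : s₁ ∈ Ioo (s₁ - η) (s₁ + η) := ⟨by linarith, by linarith⟩
    have hd1 : ∀ t ∈ Ioo (s₁ - η) (s₁ + η), HasDerivAt (fun t => (α (z, t)).1) 0 t :=
      fun t ht => (hd t ht).fst
    have hd2 : ∀ t ∈ Ioo (s₁ - η) (s₁ + η), HasDerivAt (fun t => (α (z, t)).2.1 - t) 0 t :=
      fun t ht => by
        have h1 : HasDerivAt (fun t => (α (z, t)).2.1) 1 t := (hd t ht).snd.fst
        simpa only [sub_self] using h1.fun_sub (hasDerivAt_id' t)
    have hz0 : α (z, s₁) = z := (hα z hz).1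
    intro t ht
    refine ⟨hd t ht, ?_, ?_⟩
    · have := isOpen_Ioo.is_const_of_deriv_eq_zero isPreconnected_Ioo
        (fun t ht => (hd1 t ht).differentiableAt.differentiableWithinAt)
        (fun t ht => (hd1 t ht).deriv) ht hs₁
      simpa only [hz0] using this
    · have := isOpen_Ioo.is_const_of_deriv_eq_zero isPreconnected_Ioo
        (fun t ht => (hd2 t ht).differentiableAt.differentiableWithinAt)
        (fun t ht => (hd2 t ht).deriv) ht hs₁
      simp only [hz0, hz1] at this
      linarith
  let S : ℝ → ℝ × ℝ × E := fun μ => (μ, s₁, P μ)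
  have hSc : ∀ᶠ μ in 𝓝 μ₀, ContinuousAt S μ := hP.mono fun μ hμ =>
    continuousAt_id.prodMk (continuousAt_const.prodMk hμ)
  have hS₀ : S μ₀ = (μ₀, s₁, q₀) := by simp [S, hP₀]
  have hball : ∀ᶠ μ in 𝓝 μ₀, S μ ∈ Metric.ball (μ₀, s₁, q₀) (r : ℝ) := by
    refine hSc.self_of_nhds.eventually_mem ?_
    rw [hS₀]
    exact Metric.ball_mem_nhds _ hr'
  have hαat : ContinuousAt α ((μ₀, s₁, q₀), s₁) :=
    hαc.continuousAt (prod_mem_nhds (Metric.closedBall_mem_nhds _ hr')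
      (Icc_mem_nhds (by linarith) (by linarith)))
  have hO' : ∀ᶠ y : ℝ × ℝ in 𝓝 (μ₀, s₁), α (S y.1, y.2) ∈ O := by
    have h1 : ContinuousAt (fun y : ℝ × ℝ => (S y.1, y.2)) (μ₀, s₁) :=
      (ContinuousAt.comp (g := S) hSc.self_of_nhds continuousAt_fst).prodMk continuousAt_snd
    have h2 : ContinuousAt (fun y : ℝ × ℝ => α (S y.1, y.2)) (μ₀, s₁) :=
      ContinuousAt.comp (g := α) (f := fun y : ℝ × ℝ => (S y.1, y.2))
        (by simpa only [hS₀] using hαat) h1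
    refine h2.eventually_mem ?_
    simp only [hS₀]
    rwa [(hα _ (Metric.mem_closedBall_self hr'.le)).1]
  rw [nhds_prod_eq] at hO'
  obtain ⟨A, hA, B, hB, hAB⟩ := Filter.mem_prod_iff.1 hO'
  obtain ⟨ε, hε, hεA⟩ := Metric.mem_nhds_iff.1 (inter_mem hA (hSc.and hball))
  obtain ⟨δ, hδ, hδB⟩ := Metric.mem_nhds_iff.1
    (inter_mem hB (Ioo_mem_nhds (a := s₁ - η) (b := s₁ + η) (by linarith) (by linarith)))
  rw [Real.ball_eq_Ioo] at hεA hδB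
  refine ⟨ε, hε, δ, hδ, fun μ s => (α (S μ, s)).2.2, ?_, fun μ hμ => ⟨?_, fun s hs => ?_⟩⟩
  · rintro ⟨μ, s⟩ ⟨hμ, hs⟩
    have h1 : ContinuousAt α (S μ, s) := hαc.continuousAt (prod_mem_nhds
      (mem_of_superset (Metric.isOpen_ball.mem_nhds (hεA hμ).2.2) Metric.ball_subset_closedBall)
      (Icc_mem_nhds (hδB hs).2.1 (hδB hs).2.2))
    have h2 : ContinuousAt (fun y : ℝ × ℝ => (S y.1, y.2)) (μ, s) :=
      (ContinuousAt.comp (g := S) (hεA hμ).2.1 continuousAt_fst).prodMk continuousAt_snd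
    exact (ContinuousAt.comp (g := α) (f := fun y : ℝ × ℝ => (S y.1, y.2)) h1
      h2).snd.snd.continuousWithinAt
  · have := (hα (S μ) (Metric.ball_subset_closedBall (hεA hμ).2.2)).1
    simp only [this, S]
  · have h1 := hcomp (S μ) (Metric.ball_subset_closedBall (hεA hμ).2.2) rfl s (hδB hs).2
    have h2 : α (S μ, s) = (μ, s, (α (S μ, s)).2.2) :=
      Prod.ext h1.2.1 (Prod.ext h1.2.2 rfl)
    refine ⟨?_, ?_⟩
    · rw [← h2]
      exact hAB (mk_mem_prod (hεA hμ).1 (hδB hs).1)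
    · rw [← h2]
      exact h1.1.snd.snd

theorem isInvertible_prod_of_det_ne_zero {A : ℝ × ℝ →L[ℝ] ℝ × ℝ} {a b c d : ℝ}
    (hA : ∀ y : ℝ × ℝ, A y = (y.1 * a + y.2 * b, y.1 * c + y.2 * d)) (hdet : a * d - b * c ≠ 0) :
    A.IsInvertible := by
  let B : ℝ × ℝ →L[ℝ] ℝ × ℝ := LinearMap.toContinuousLinearMap
    { toFun := fun y => ((a * d - b * c)⁻¹ * (d * y.1 - b * y.2),
        (a * d - b * c)⁻¹ * (a * y.2 - c * y.1))
      map_add' := fun x y => by ext <;> simp <;> ring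
      map_smul' := fun r y => by ext <;> simp <;> ring }
  have hB : ∀ y : ℝ × ℝ, B y = ((a * d - b * c)⁻¹ * (d * y.1 - b * y.2),
        (a * d - b * c)⁻¹ * (a * y.2 - c * y.1)) := fun y => rfl
  refine ContinuousLinearMap.IsInvertible.of_inverse (g := B) ?_ ?_
  · refine ContinuousLinearMap.ext fun y => ?_
    rw [ContinuousLinearMap.comp_apply, hA, hB, ContinuousLinearMap.id_apply]
    refine Prod.ext ?_ ?_
    · simp only
      field_simp
      ring
    · simp only
      field_simp
      ring
  · refine ContinuousLinearMap.ext fun y => ?_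
    rw [ContinuousLinearMap.comp_apply, hA, hB, ContinuousLinearMap.id_apply]
    refine Prod.ext ?_ ?_
    · simp only
      field_simp
      ring
    · simp only
      field_simp
      ring

/-- Two scalar equations are solved for two unknowns, the coefficients of `w₁` and `w₂` in the
deviation from `u(s)`; `hdet` is their Jacobian. Measuring from `u(s)` makes zero deviation a
solution wherever `u` satisfies the equations, and local uniqueness then gives `V = u`. -/
theorem exists_implicit_velocity {W : E → ℝ} {Q : E × E → ℝ} {U : ℝ → ℝ} {u : ℝ → E}
    {μ₀ s₁ : ℝ} {q₀ : E} (hW : ∀ᶠ q in 𝓝 q₀, ContDiffAt ℝ ∞ W q)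
    (hQ : ∀ᶠ y in 𝓝 (q₀, u s₁), ContDiffAt ℝ ∞ Q y) (hU : ∀ᶠ s in 𝓝 s₁, ContDiffAt ℝ ∞ U s)
    (hu : ∀ᶠ s in 𝓝 s₁, ContDiffAt ℝ ∞ u s) {w₁ w₂ : E}
    (hdet : fderiv ℝ W q₀ w₁ * fderiv ℝ Q (q₀, u s₁) (0, w₂)
      - fderiv ℝ W q₀ w₂ * fderiv ℝ Q (q₀, u s₁) (0, w₁) ≠ 0)
    (h1 : fderiv ℝ W q₀ (u s₁) = μ₀ * deriv U s₁) (h2 : Q (q₀, u s₁) = 1) :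
    ∃ V : ℝ × ℝ × E → E, (∀ᶠ z in 𝓝 (μ₀, s₁, q₀), ContDiffAt ℝ ∞ V z) ∧
      (∀ᶠ z in 𝓝 (μ₀, s₁, q₀), fderiv ℝ W z.2.2 (V z) = z.1 * deriv U z.2.1 ∧
        Q (z.2.2, V z) = 1) ∧
      ∀ᶠ z in 𝓝 (μ₀, s₁, q₀), fderiv ℝ W z.2.2 (u z.2.1) = z.1 * deriv U z.2.1 →
        Q (z.2.2, u z.2.1) = 1 → V z = u z.2.1 := by
  let v : (ℝ × ℝ × E) × (ℝ × ℝ) → E := fun y => u y.1.2.1 + (y.2.1 • w₁ + y.2.2 • w₂)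
  let f : (ℝ × ℝ × E) × (ℝ × ℝ) → ℝ × ℝ := fun y =>
    (fderiv ℝ W y.1.2.2 (v y) - y.1.1 * deriv U y.1.2.1, Q (y.1.2.2, v y) - 1)
  have hv₀ : v ((μ₀, s₁, q₀), (0, 0)) = u s₁ := by simp [v]
  have hvs : ∀ y : (ℝ × ℝ × E) × (ℝ × ℝ), ContDiffAt ℝ ∞ u y.1.2.1 → ContDiffAt ℝ ∞ v y := by
    intro y hy
    have h3 : ContDiffAt ℝ ∞ (fun y : (ℝ × ℝ × E) × (ℝ × ℝ) => u y.1.2.1) y :=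
      ContDiffAt.comp (g := u) (f := fun y : (ℝ × ℝ × E) × (ℝ × ℝ) => y.1.2.1) y hy (by fun_prop)
    exact h3.add (by fun_prop)
  have hfs : ∀ᶠ y in 𝓝 ((μ₀, s₁, q₀), ((0 : ℝ), (0 : ℝ))), ContDiffAt ℝ ∞ f y := by
    have t1 : Tendsto (fun y : (ℝ × ℝ × E) × (ℝ × ℝ) => y.1.2.2)
        (𝓝 ((μ₀, s₁, q₀), ((0 : ℝ), (0 : ℝ)))) (𝓝 q₀) := Continuous.tendsto (by fun_prop) _
    have t2 : Tendsto (fun y : (ℝ × ℝ × E) × (ℝ × ℝ) => y.1.2.1)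
        (𝓝 ((μ₀, s₁, q₀), ((0 : ℝ), (0 : ℝ)))) (𝓝 s₁) := Continuous.tendsto (by fun_prop) _
    have t3 : Tendsto (fun y : (ℝ × ℝ × E) × (ℝ × ℝ) => (y.1.2.2, v y))
        (𝓝 ((μ₀, s₁, q₀), ((0 : ℝ), (0 : ℝ)))) (𝓝 (q₀, u s₁)) := by
      have := (hvs ((μ₀, s₁, q₀), (0, 0)) hu.self_of_nhds).continuousAt
      rw [ContinuousAt, hv₀] at this
      exact t1.prodMk_nhds this
    filter_upwards [t1.eventually hW, t2.eventually hU, t2.eventually hu, t3.eventually hQ]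
      with y hWy hUy huy hQy
    refine ContDiffAt.prodMk ?_ ?_
    · have h3 : ContDiffAt ℝ ∞ (fun y : (ℝ × ℝ × E) × (ℝ × ℝ) => fderiv ℝ W y.1.2.2) y :=
        ContDiffAt.comp (g := fderiv ℝ W) (f := fun y : (ℝ × ℝ × E) × (ℝ × ℝ) => y.1.2.2) y
          (hWy.fderiv_right (by simp)) (by fun_prop)
      have h4 : ContDiffAt ℝ ∞ (fun y : (ℝ × ℝ × E) × (ℝ × ℝ) => deriv U y.1.2.1) y :=
        ContDiffAt.comp (g := deriv U) (f := fun y : (ℝ × ℝ × E) × (ℝ × ℝ) => y.1.2.1) y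
          ((hUy.fderiv_right (m := ∞) (by simp)).clm_apply contDiffAt_const) (by fun_prop)
      exact (h3.clm_apply (hvs y huy)).sub
        (ContDiffAt.mul (by fun_prop) h4)
    · exact (ContDiffAt.comp (g := Q) (f := fun y : (ℝ × ℝ × E) × (ℝ × ℝ) => (y.1.2.2, v y)) y hQy
        (ContDiffAt.prodMk (by fun_prop) (hvs y huy))).sub contDiffAt_const
  have hf₀ : f ((μ₀, s₁, q₀), (0, 0)) = 0 := by
    simp only [f, hv₀, h1, h2, sub_self]
    rfl
  have hinv : (fderiv ℝ f ((μ₀, s₁, q₀), (0, 0)) ∘L .inr ℝ (ℝ × ℝ × E) (ℝ × ℝ)).IsInvertible := by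
    have d1 := (hfs.self_of_nhds.differentiableAt (by simp)).hasFDerivAt.comp (0, 0)
      (hasFDerivAt_prodMk_right (𝕜 := ℝ) (μ₀, s₁, q₀) ((0 : ℝ), (0 : ℝ)))
    have d2 : HasFDerivAt (fun y : ℝ × ℝ => v ((μ₀, s₁, q₀), y))
        ((ContinuousLinearMap.fst ℝ ℝ ℝ).smulRight w₁ +
          (ContinuousLinearMap.snd ℝ ℝ ℝ).smulRight w₂)
        (0, 0) :=
      (((hasFDerivAt_fst (𝕜 := ℝ)).smul_const w₁).add
        ((hasFDerivAt_snd (𝕜 := ℝ)).smul_const w₂)).const_add (u s₁)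
    have d3 := ((fderiv ℝ W q₀).hasFDerivAt.comp ((0 : ℝ), (0 : ℝ)) d2).sub_const
      (μ₀ * deriv U s₁)
    have d4 : HasFDerivAt Q (fderiv ℝ Q (q₀, u s₁)) (q₀, v ((μ₀, s₁, q₀), (0, 0))) := by
      rw [hv₀]
      exact (hQ.self_of_nhds.differentiableAt (by simp)).hasFDerivAt
    have d5 := (d4.comp ((0 : ℝ), (0 : ℝ)) ((hasFDerivAt_const q₀ _).prodMk d2)).sub_const (1 : ℝ)
    rw [d1.unique (d3.prodMk d5)]
    refine isInvertible_prod_of_det_ne_zero (fun y => ?_) hdet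
    have e1 : ((0 : E), y.1 • w₁ + y.2 • w₂) = y.1 • ((0 : E), w₁) + y.2 • ((0 : E), w₂) := by
      simp
    refine Prod.ext ?_ ?_
    · simp
    · change fderiv ℝ Q (q₀, u s₁) ((0 : E), y.1 • w₁ + y.2 • w₂) = _
      rw [e1, map_add, map_smul, map_smul]
      rfl
  obtain ⟨ψ, hψ₀, hψs, hψf, hψu⟩ := exists_implicit hfs hinv hf₀
  have t2 : Tendsto (fun z : ℝ × ℝ × E => z.2.1) (𝓝 (μ₀, s₁, q₀)) (𝓝 s₁) :=
    Continuous.tendsto (by fun_prop) _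
  refine ⟨fun z => v (z, ψ z), ?_, ?_, ?_⟩
  · filter_upwards [hψs, t2.eventually hu] with z hz hz'
    exact ContDiffAt.comp (g := v) (f := fun z => (z, ψ z)) z (hvs _ hz') (contDiffAt_id.prodMk hz)
  · filter_upwards [hψf] with z hz
    exact ⟨sub_eq_zero.1 (congrArg Prod.fst hz), sub_eq_zero.1 (congrArg Prod.snd hz)⟩
  · have t3 : Tendsto (fun z : ℝ × ℝ × E => (z, ((0 : ℝ), (0 : ℝ)))) (𝓝 (μ₀, s₁, q₀))
        (𝓝 ((μ₀, s₁, q₀), (0, 0))) := Continuous.tendsto (by fun_prop) _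
    filter_upwards [t3.eventually hψu] with z hz h3 h4
    have h5 : ψ z = (0, 0) := by
      refine hz (Prod.ext ?_ ?_)
      · simp [f, v, h3]
      · simp [f, v, h4]
    simp [v, h5]

end Family

end

/-- Integrate the velocity field `V`, starting at points with `W = μ U(s₁)`. The last clause is
uniqueness: a reference curve with velocity `u` that meets the constraints solves the same ODE. -/
theorem exists_curve_family {E : Type*} [NormedAddCommGroup E] [NormedSpace ℝ E] [CompleteSpace E]
    {W : E → ℝ} {Q : E × E → ℝ} {U : ℝ → ℝ} {u : ℝ → E}
    {μ₀ s₁ : ℝ} {q₀ : E} (hW : ∀ᶠ q in 𝓝 q₀, ContDiffAt ℝ ∞ W q)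
    (hQ : ∀ᶠ y in 𝓝 (q₀, u s₁), ContDiffAt ℝ ∞ Q y) (hU : ∀ᶠ s in 𝓝 s₁, ContDiffAt ℝ ∞ U s)
    (hu : ∀ᶠ s in 𝓝 s₁, ContDiffAt ℝ ∞ u s) {w₁ w₂ : E}
    (hdet : fderiv ℝ W q₀ w₁ * fderiv ℝ Q (q₀, u s₁) (0, w₂)
      - fderiv ℝ W q₀ w₂ * fderiv ℝ Q (q₀, u s₁) (0, w₁) ≠ 0)
    (hw₁ : fderiv ℝ W q₀ w₁ ≠ 0)
    (h1 : fderiv ℝ W q₀ (u s₁) = μ₀ * deriv U s₁) (h2 : Q (q₀, u s₁) = 1)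
    (h0 : W q₀ = μ₀ * U s₁) {Ω : Set E} (hΩ : Ω ∈ 𝓝 q₀) :
    ∃ ε > 0, ∃ δ > 0, ∃ c : ℝ → ℝ → E,
      ContinuousOn (fun q : ℝ × ℝ => c q.1 q.2)
        (Ioo (μ₀ - ε) (μ₀ + ε) ×ˢ Ioo (s₁ - δ) (s₁ + δ)) ∧ c μ₀ s₁ = q₀ ∧
      (∀ μ ∈ Ioo (μ₀ - ε) (μ₀ + ε), ContDiffOn ℝ ∞ (c μ) (Ioo (s₁ - δ) (s₁ + δ)) ∧
        ∀ s ∈ Ioo (s₁ - δ) (s₁ + δ), c μ s ∈ Ω ∧ W (c μ s) = μ * U s ∧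
          Q (c μ s, deriv (c μ) s) = 1) ∧
      ∀ c₀ : ℝ → E, c₀ s₁ = q₀ → (∀ᶠ s in 𝓝 s₁, HasDerivAt c₀ (u s) s ∧
        W (c₀ s) = μ₀ * U s ∧ Q (c₀ s, u s) = 1) → ∀ᶠ s in 𝓝 s₁, c μ₀ s = c₀ s := by
  obtain ⟨V, hVs, hVe, hVu⟩ := exists_implicit_velocity hW hQ hU hu hdet h1 h2
  obtain ⟨P, hP₀, hPc, hPW⟩ := exists_level_curve hW hw₁ h0
  have t1 : Tendsto (fun z : ℝ × ℝ × E => z.2.2) (𝓝 (μ₀, s₁, q₀)) (𝓝 q₀) :=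
    Continuous.tendsto (by fun_prop) _
  have t2 : Tendsto (fun z : ℝ × ℝ × E => z.2.1) (𝓝 (μ₀, s₁, q₀)) (𝓝 s₁) :=
    Continuous.tendsto (by fun_prop) _
  obtain ⟨K, T, hT, hVL⟩ := ContDiffAt.exists_lipschitzOnWith
    (hVs.self_of_nhds.of_le (m := 1) (by simp))
  have hO := hVs.and (hVe.and ((t1.eventually hW).and ((t2.eventually hU).and
    ((t1.eventually hΩ).and hT))))
  obtain ⟨ε₁, hε₁, δ, hδ, c, hcc, hc⟩ := exists_flow_family
    (hVs.self_of_nhds.of_le (by simp)) hPc hP₀ hO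
  obtain ⟨ε₂, hε₂, hPε⟩ := Metric.eventually_nhds_iff_ball.1 hPW
  rw [Real.ball_eq_Ioo] at hPε
  have hs₁ : s₁ ∈ Ioo (s₁ - δ) (s₁ + δ) := ⟨by linarith, by linarith⟩
  have hμ₀ : μ₀ ∈ Ioo (μ₀ - ε₁) (μ₀ + ε₁) := ⟨by linarith, by linarith⟩
  have hsub : Ioo (μ₀ - min ε₁ ε₂) (μ₀ + min ε₁ ε₂) ⊆
      Ioo (μ₀ - ε₁) (μ₀ + ε₁) ∩ Ioo (μ₀ - ε₂) (μ₀ + ε₂) := by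
    intro x hx
    have := min_le_left ε₁ ε₂
    have := min_le_right ε₁ ε₂
    exact ⟨⟨by linarith [hx.1], by linarith [hx.2]⟩, ⟨by linarith [hx.1], by linarith [hx.2]⟩⟩
  refine ⟨min ε₁ ε₂, lt_min hε₁ hε₂, δ, hδ, c,
    hcc.mono (prod_mono (hsub.trans inter_subset_left) subset_rfl), ?_, fun μ hμ => ⟨?_, ?_⟩, ?_⟩
  · rw [(hc μ₀ hμ₀).1, hP₀]
  · refine contDiffOn_of_ode isOpen_Ioo (V := fun y => V (μ, y.1, y.2)) (fun s hs => ?_)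
      (fun s hs => ((hc μ (hsub hμ).1).2 s hs).2)
    exact ContDiffAt.comp (g := V) (f := fun y : ℝ × E => (μ, y.1, y.2)) (s, c μ s)
      ((hc μ (hsub hμ).1).2 s hs).1.1 (by fun_prop)
  · obtain ⟨hcP, hcs⟩ := hc μ (hsub hμ).1
    -- The first equation defining `V` says that this difference is a first integral; it vanishes at
    -- `s₁` by the choice of `P`.
    have hd : ∀ s ∈ Ioo (s₁ - δ) (s₁ + δ), HasDerivAt (fun s => W (c μ s) - μ * U s) 0 s := by
      intro s hs
      obtain ⟨⟨-, h3, h4, h5, -⟩, h6⟩ := hcs s hs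
      have h7 := (h4.differentiableAt (by simp)).hasFDerivAt.comp_hasDerivAt s h6
      have h8 := (h5.differentiableAt (by simp)).hasDerivAt.const_mul μ
      have h9 := h7.sub h8
      rwa [h3.1, sub_self] at h9
    intro s hs
    refine ⟨(hcs s hs).1.2.2.2.2.1, ?_, ?_⟩
    · have h3 := isOpen_Ioo.is_const_of_deriv_eq_zero isPreconnected_Ioo
        (fun s hs => (hd s hs).differentiableAt.differentiableWithinAt)
        (fun s hs => (hd s hs).deriv) hs hs₁
      simp only [hcP, hPε μ (hsub hμ).2, sub_self] at h3
      linarith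
    · rw [((hcs s hs).2).deriv]
      exact (hcs s hs).1.2.1.2
  · intro c₀ hc₀ hc₀e
    have hcont : ContinuousAt c₀ s₁ := hc₀e.self_of_nhds.1.continuousAt
    have t3 : Tendsto (fun s => (μ₀, s, c₀ s)) (𝓝 s₁) (𝓝 (μ₀, s₁, q₀)) := by
      have h3 : ContinuousAt (fun s => (μ₀, s, c₀ s)) s₁ :=
        continuousAt_const.prodMk (continuousAt_id.prodMk hcont)
      rwa [ContinuousAt, hc₀] at h3
    have hode : ∀ᶠ s in 𝓝 s₁, HasDerivAt (fun s => (μ₀, s, c₀ s))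
        ((0 : ℝ), (1 : ℝ), V (μ₀, s, c₀ s)) s ∧ (μ₀, s, c₀ s) ∈ T := by
      filter_upwards [eventually_eventually_nhds.2 hc₀e, t3.eventually hO, t3.eventually hVu]
        with s h3 h4 h5
      obtain ⟨h6, -, h7⟩ := h3.self_of_nhds
      refine ⟨(hasDerivAt_const s μ₀).prodMk ((hasDerivAt_id s).prodMk ?_), h4.2.2.2.2.2⟩
      have h8 := (h4.2.2.1.differentiableAt (by simp)).hasFDerivAt.comp_hasDerivAt s h6
      have h9 := (h4.2.2.2.1.differentiableAt (by simp)).hasDerivAt.const_mul μ₀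
      have h10 : W ∘ c₀ =ᶠ[𝓝 s] fun s => μ₀ * U s := h3.mono fun s hs => hs.2.1
      -- Differentiating the constraint on `c₀` gives the linear equation for `u`, so `V = u` along
      -- `c₀`.
      rw [h5 ((h8.congr_of_eventuallyEq h10.symm).unique h9) h7]
      exact h6
    have hode' : ∀ᶠ s in 𝓝 s₁, HasDerivAt (fun s => (μ₀, s, c μ₀ s))
        ((0 : ℝ), (1 : ℝ), V (μ₀, s, c μ₀ s)) s ∧ (μ₀, s, c μ₀ s) ∈ T := by
      filter_upwards [isOpen_Ioo.mem_nhds hs₁] with s hs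
      obtain ⟨h3, h4⟩ := (hc μ₀ hμ₀).2 s hs
      exact ⟨(hasDerivAt_const s μ₀).prodMk ((hasDerivAt_id s).prodMk h4), h3.2.2.2.2.2⟩
    have hL : LipschitzOnWith (max 0 (max 0 K)) (fun z : ℝ × ℝ × E => ((0 : ℝ), (1 : ℝ), V z)) T :=
      (LipschitzWith.const (0 : ℝ)).lipschitzOnWith.prodMk
        ((LipschitzWith.const (1 : ℝ)).lipschitzOnWith.prodMk hVL)
    have := ODE_solution_unique_of_eventually
      (v := fun _ z => ((0 : ℝ), (1 : ℝ), V z)) (s := fun _ => T) (Eventually.of_forall fun _ => hL)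
      hode' hode (by simp [(hc μ₀ hμ₀).1, hP₀, hc₀])
    filter_upwards [this] with s hs
    exact congrArg (fun z => z.2.2) hs

/-! ### Charts and the quadratic form of the orbit space -/

section

section

variable {N : Type*} [TopologicalSpace N] [ChartedSpace E3 N]

theorem exists_local_parametrization [IsManifold (𝓡 3) ∞ N] (p : N) :
    ∃ (ψ : E3 → N) (χ : N → E3) (T : Set E3), IsOpen T ∧ χ p ∈ T ∧ ψ (χ p) = p ∧
      ContMDiffOn 𝓘(ℝ, E3) (𝓡 3) ∞ ψ T ∧
      (∀ᶠ q in 𝓝 p, ψ (χ q) = q ∧ ContMDiffAt (𝓡 3) 𝓘(ℝ, E3) ∞ χ q) ∧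
      Function.Surjective (mfderiv 𝓘(ℝ, E3) (𝓡 3) ψ (χ p)) := by
  have hT : IsOpen (extChartAt (𝓡 3) p).target := isOpen_extChartAt_target p
  have hψ : ContMDiffOn 𝓘(ℝ, E3) (𝓡 3) ∞ (extChartAt (𝓡 3) p).symm (extChartAt (𝓡 3) p).target :=
    contMDiffOn_extChartAt_symm p
  have hev : ∀ᶠ q in 𝓝 p, (extChartAt (𝓡 3) p).symm (extChartAt (𝓡 3) p q) = q ∧
      ContMDiffAt (𝓡 3) 𝓘(ℝ, E3) ∞ (extChartAt (𝓡 3) p) q := by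
    filter_upwards [extChartAt_source_mem_nhds (I := 𝓡 3) p] with q hq
    refine ⟨(extChartAt (𝓡 3) p).left_inv hq, ?_⟩
    rw [extChartAt_source] at hq
    exact contMDiffAt_extChartAt' hq
  have hp : extChartAt (𝓡 3) p p ∈ (extChartAt (𝓡 3) p).target := mem_extChartAt_target p
  refine ⟨(extChartAt (𝓡 3) p).symm, extChartAt (𝓡 3) p, (extChartAt (𝓡 3) p).target, hT, hp,
    hev.self_of_nhds.1, hψ, hev, ?_⟩
  have h1 := mfderiv_comp p ((hψ.contMDiffAt (hT.mem_nhds hp)).mdifferentiableAt (by simp))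
    (hev.self_of_nhds.2.mdifferentiableAt (by simp))
  have h2 : (extChartAt (𝓡 3) p).symm ∘ extChartAt (𝓡 3) p =ᶠ[𝓝 p] id :=
    hev.mono fun q hq => hq.1
  rw [h2.mfderiv_eq, mfderiv_id] at h1
  intro v
  refine ⟨mfderiv (𝓡 3) 𝓘(ℝ, E3) (extChartAt (𝓡 3) p) p v, ?_⟩
  exact (congrArg (fun L => L v) h1).symm

theorem velocity_comp {ψ : E3 → N} {c : ℝ → E3} {s : ℝ}
    (hψ : MDifferentiableAt 𝓘(ℝ, E3) (𝓡 3) ψ (c s)) (hc : DifferentiableAt ℝ c s) :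
    velocity (fun s => ψ (c s)) s = mfderiv 𝓘(ℝ, E3) (𝓡 3) ψ (c s) (deriv c s) := by
  have h1 := mfderiv_comp_apply (I' := 𝓘(ℝ, E3)) s hψ hc.mdifferentiableAt (1 : ℝ)
  rw [mfderiv_eq_fderiv] at h1
  exact h1

end

variable {N : Type*} [TopologicalSpace N] [ChartedSpace E3 N] [IsManifold (𝓡 3) ∞ N]
  {g : Metric N} {X : (p : N) → TangentSpace (𝓡 3) p} {φ : ℝ → N → N}

theorem orbitNormSq_velocity_congr {γ γ' : ℝ → N} {s : ℝ} (h : γ =ᶠ[𝓝 s] γ') :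
    orbitNormSq g X (γ s) (velocity γ s) = orbitNormSq g X (γ' s) (velocity γ' s) := by
  unfold velocity
  rw [h.mfderiv_eq]
  exact congrArg (fun p => (orbitNormSq g X p : E3 → ℝ)
    (mfderiv 𝓘(ℝ, ℝ) (𝓡 3) γ' s (1 : ℝ))) h.eq_of_nhds

/-- The polar form of `orbitNormSq`. -/
noncomputable def orbitInner (g : Metric N) (X : (p : N) → TangentSpace (𝓡 3) p) (p : N)
    (v w : TangentSpace (𝓡 3) p) : ℝ :=
  g.inner p v w - g.inner p v (X p) * g.inner p w (X p) / g.inner p (X p) (X p)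

theorem orbitNormSq_nonneg (p : N) (w : TangentSpace (𝓡 3) p) : 0 ≤ orbitNormSq g X p w :=
  inner_self_nonneg g p _

theorem orbitNormSq_add_smul {p : N} (h : g.inner p (X p) (X p) ≠ 0)
    (v w : TangentSpace (𝓡 3) p) (t : ℝ) :
    orbitNormSq g X p (v + t • w)
      = orbitNormSq g X p v + t * (2 * orbitInner g X p v w) + t ^ 2 * orbitNormSq g X p w := by
  simp only [orbitNormSq_eq _ _ h, orbitInner, map_add, map_smul, add_apply, smul_apply,
    smul_eq_mul, g.symm p w v]
  field_simp
  ring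

/-- Cauchy-Schwarz for the semidefinite form `orbitNormSq`, followed by the fact that projecting
orthogonally to `X` shortens vectors. -/
theorem abs_orbitInner_le {p : N} (h : 0 < g.inner p (X p) (X p))
    {v : TangentSpace (𝓡 3) p} (hv : orbitNormSq g X p v = 1) (w : TangentSpace (𝓡 3) p) :
    |orbitInner g X p v w| ≤ √(g.inner p w w) := by
  have h1 := orbitNormSq_add_smul h.ne' w v (-orbitInner g X p v w)
  have h2 : orbitInner g X p w v = orbitInner g X p v w := by
    simp only [orbitInner, g.symm p w v, mul_comm]
  have h3 := orbitNormSq_nonneg (g := g) (X := X) p (w + (-orbitInner g X p v w) • v)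
  have h4 : orbitNormSq g X p w ≤ g.inner p w w := by
    rw [orbitNormSq_eq _ _ h.ne']
    have : 0 ≤ g.inner p w (X p) ^ 2 / g.inner p (X p) (X p) := by positivity
    linarith
  rw [h1, h2, hv] at h3
  apply Real.abs_le_sqrt
  nlinarith

theorem IsKillingFlow.mdifferentiableAt_volumeFn (hX : IsKillingFlow g X φ) {p : N}
    (hp : 0 < volumeFn g X p) : MDifferentiableAt (𝓡 3) 𝓘(ℝ, ℝ) (volumeFn g X) p := by
  have h1 : DifferentiableAt ℝ Real.sqrt (g.inner p (X p) (X p)) :=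
    (Real.hasDerivAt_sqrt (inner_field_pos_of_volumeFn_pos hp).ne').differentiableAt
  exact h1.mdifferentiableAt.comp p (hX.mdifferentiable_inner_field p)

theorem IsKillingFlow.mfderiv_volumeFn_field (hX : IsKillingFlow g X φ) {p : N}
    (hp : 0 < volumeFn g X p) : mfderiv (𝓡 3) 𝓘(ℝ, ℝ) (volumeFn g X) p (X p) = (0 : ℝ) := by
  have h0 := hp
  rw [← hX.map_zero p] at h0
  have h1 := mfderiv_comp_apply (0 : ℝ) (hX.mdifferentiableAt_volumeFn h0)
    (hX.integralCurve p 0).mdifferentiableAt (1 : ℝ)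
  have h2 : (volumeFn g X ∘ fun t => φ t p) = fun _ => volumeFn g X p := by
    ext t
    exact hX.volumeFn_flow t p
  have h3 := hX.mfderiv_time 0 p 1
  rw [one_smul] at h3
  rw [h2, mfderiv_const, h3, hX.map_zero] at h1
  exact h1.symm

section Chart

variable {ψ : E3 → N} {T : Set E3}

theorem contDiffAt_volumeFn_comp (hX : IsKillingFlow g X φ) (hT : IsOpen T)
    (hψ : ContMDiffOn 𝓘(ℝ, E3) (𝓡 3) ∞ ψ T) {q : E3} (hq : q ∈ T)
    (hpos : 0 < volumeFn g X (ψ q)) : ContDiffAt ℝ ∞ (fun q => volumeFn g X (ψ q)) q := by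
  have h1 : ContMDiffAt 𝓘(ℝ, E3) (𝓡 3).tangent ∞
      (fun q => (⟨ψ q, X (ψ q)⟩ : TangentBundle (𝓡 3) N)) q :=
    hX.contMDiff_field.contMDiffAt.comp q (hψ.contMDiffAt (hT.mem_nhds hq))
  exact (contMDiffAt_inner g h1 h1).sqrt (inner_field_pos_of_volumeFn_pos hpos).ne'

theorem contDiffAt_orbitNormSq_comp (hX : IsKillingFlow g X φ) (hT : IsOpen T)
    (hψ : ContMDiffOn 𝓘(ℝ, E3) (𝓡 3) ∞ ψ T) {y : E3 × E3} (hy : y.1 ∈ T)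
    (hpos : 0 < volumeFn g X (ψ y.1)) :
    ContDiffAt ℝ ∞ (fun y : E3 × E3 =>
      orbitNormSq g X (ψ y.1) (mfderiv 𝓘(ℝ, E3) (𝓡 3) ψ y.1 y.2)) y := by
  have hψy := hψ.contMDiffAt (hT.mem_nhds hy)
  have h1 : ContMDiffAt 𝓘(ℝ, E3 × E3) (𝓡 3).tangent ∞
      (fun y : E3 × E3 => (⟨ψ y.1, X (ψ y.1)⟩ : TangentBundle (𝓡 3) N)) y :=
    hX.contMDiff_field.contMDiffAt.comp y
      (hψy.comp y contDiff_fst.contMDiff.contMDiffAt)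
  have h2 := (contMDiffOn_mfderiv hT hψ).contMDiffAt
    ((hT.prod isOpen_univ).mem_nhds (⟨hy, mem_univ _⟩ : y ∈ T ×ˢ univ))
  have hA := inner_field_pos_of_volumeFn_pos hpos
  have h3 := (contMDiffAt_inner g h2 h2).sub
    (((contMDiffAt_inner g h2 h1).pow 2).div (contMDiffAt_inner g h1 h1) hA.ne')
  refine h3.congr_of_eventuallyEq ?_
  filter_upwards [(contMDiffAt_inner g h1 h1).continuousAt.eventually (lt_mem_nhds hA)] with z hz
  exact orbitNormSq_eq _ _ hz.ne'

theorem fderiv_volumeFn_comp (hX : IsKillingFlow g X φ) {q : E3}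
    (hψ : MDifferentiableAt 𝓘(ℝ, E3) (𝓡 3) ψ q) (hpos : 0 < volumeFn g X (ψ q)) (v : E3) :
    fderiv ℝ (fun q => volumeFn g X (ψ q)) q v
      = mfderiv (𝓡 3) 𝓘(ℝ, ℝ) (volumeFn g X) (ψ q) (mfderiv 𝓘(ℝ, E3) (𝓡 3) ψ q v) := by
  have h1 := mfderiv_comp_apply q (hX.mdifferentiableAt_volumeFn hpos) hψ v
  rw [mfderiv_eq_fderiv] at h1
  exact h1

theorem fderiv_orbitNormSq_comp (hX : IsKillingFlow g X φ) (hT : IsOpen T)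
    (hψ : ContMDiffOn 𝓘(ℝ, E3) (𝓡 3) ∞ ψ T) {q : E3} (hq : q ∈ T)
    (hpos : 0 < volumeFn g X (ψ q)) (v w : E3) :
    fderiv ℝ (fun y : E3 × E3 => orbitNormSq g X (ψ y.1) (mfderiv 𝓘(ℝ, E3) (𝓡 3) ψ y.1 y.2))
      (q, v) (0, w) = 2 * orbitInner g X (ψ q) (mfderiv 𝓘(ℝ, E3) (𝓡 3) ψ q v)
        (mfderiv 𝓘(ℝ, E3) (𝓡 3) ψ q w) := by
  have h1 := ((contDiffAt_orbitNormSq_comp hX hT hψ (y := (q, v)) hq hpos).differentiableAt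
    (by simp)).hasFDerivAt.hasLineDerivAt ((0 : E3), w)
  set D := mfderiv 𝓘(ℝ, E3) (𝓡 3) ψ q with hD
  have hA := (inner_field_pos_of_volumeFn_pos hpos).ne'
  have h2 : (fun t : ℝ => orbitNormSq g X (ψ ((q, v) + t • ((0 : E3), w)).1)
      (mfderiv 𝓘(ℝ, E3) (𝓡 3) ψ ((q, v) + t • ((0 : E3), w)).1 ((q, v) + t • ((0 : E3), w)).2))
      = fun t => orbitNormSq g X (ψ q) (D v) + t * (2 * orbitInner g X (ψ q) (D v) (D w))
        + t ^ 2 * orbitNormSq g X (ψ q) (D w) := by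
    ext t
    rw [← orbitNormSq_add_smul hA]
    have h3 : ((q, v) + t • ((0 : E3), w)).1 = q := by simp
    rw [h3]
    congr 1
    exact (D.map_add v (t • w)).trans (congrArg (D v + ·) (D.map_smul t w))
  have h4 : HasDerivAt (fun t => orbitNormSq g X (ψ q) (D v)
      + t * (2 * orbitInner g X (ψ q) (D v) (D w)) + t ^ 2 * orbitNormSq g X (ψ q) (D w))
      (2 * orbitInner g X (ψ q) (D v) (D w)) 0 := by
    have h5 := (((hasDerivAt_id' (0 : ℝ)).mul_const
      (2 * orbitInner g X (ψ q) (D v) (D w))).const_add (orbitNormSq g X (ψ q) (D v))).fun_add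
      ((hasDerivAt_pow 2 (0 : ℝ)).mul_const (orbitNormSq g X (ψ q) (D w)))
    simpa using h5
  rw [HasLineDerivAt, h2] at h1
  exact h1.unique h4

end Chart

end

/-! ### Continuous families of profiles -/

section

variable {N : Type*} [TopologicalSpace N] [ChartedSpace E3 N] [IsManifold (𝓡 3) ∞ N]
  {g : Metric N} {X : (p : N) → TangentSpace (𝓡 3) p} {φ : ℝ → N → N}

/-- The curve family applied to `W = ω ∘ ψ` and `Q = orbitNormSq`, with the positive parameter `μ =
|m|`, since a profile depends on `m` only through `|m|`. -/
theorem exists_profile_family_in_chart (hX : IsKillingFlow g X φ) {U : ℝ → ℝ} {I : Set ℝ}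
    (hI : IsOpen I) (hU : ContDiffOn ℝ ∞ U I) (hUpos : ∀ s ∈ I, 0 < U s) {ψ : E3 → N} {T : Set E3}
    (hT : IsOpen T) (hψ : ContMDiffOn 𝓘(ℝ, E3) (𝓡 3) ∞ ψ T) {q₀ : E3} (hq₀ : q₀ ∈ T)
    (hsurj : Function.Surjective (mfderiv 𝓘(ℝ, E3) (𝓡 3) ψ q₀)) {μ₀ s₁ : ℝ} (hμ₀ : 0 < μ₀)
    (hs₁ : s₁ ∈ I) (hreg : ψ q₀ ∈ regularPart φ) (hvol : volumeFn g X (ψ q₀) = μ₀ * U s₁)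
    (hgrad : GradVolumeGT g X (ψ q₀) |μ₀ * deriv U s₁|) {u : ℝ → E3}
    (hu : ∀ᶠ s in 𝓝 s₁, ContDiffAt ℝ ∞ u s)
    (hunorm : orbitNormSq g X (ψ q₀) (mfderiv 𝓘(ℝ, E3) (𝓡 3) ψ q₀ (u s₁)) = 1)
    (huvol : fderiv ℝ (fun q => volumeFn g X (ψ q)) q₀ (u s₁) = μ₀ * deriv U s₁) :
    ∃ ε > 0, ∃ δ > 0, Ioo (s₁ - δ) (s₁ + δ) ⊆ I ∧ ∃ Γ : ℝ → ℝ → N,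
      ContinuousOn (fun q : ℝ × ℝ => Γ q.1 q.2)
        (Ioo (μ₀ - ε) (μ₀ + ε) ×ˢ Ioo (s₁ - δ) (s₁ + δ)) ∧ Γ μ₀ s₁ = ψ q₀ ∧
      (∀ μ ∈ Ioo (μ₀ - ε) (μ₀ + ε), ∀ m, |m| = μ →
        IsProfile g X φ U m (Ioo (s₁ - δ) (s₁ + δ)) (Γ μ)) ∧
      ∀ c₀ : ℝ → E3, c₀ s₁ = q₀ → (∀ᶠ s in 𝓝 s₁, HasDerivAt c₀ (u s) s ∧
        volumeFn g X (ψ (c₀ s)) = μ₀ * U s ∧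
        orbitNormSq g X (ψ (c₀ s)) (mfderiv 𝓘(ℝ, E3) (𝓡 3) ψ (c₀ s) (u s)) = 1) →
        ∀ᶠ s in 𝓝 s₁, Γ μ₀ s = ψ (c₀ s) := by
  have hpos : 0 < volumeFn g X (ψ q₀) := by
    rw [hvol]
    exact mul_pos hμ₀ (hUpos _ hs₁)
  have hψc : ContinuousAt ψ q₀ := (hψ.contMDiffAt (hT.mem_nhds hq₀)).continuousAt
  have hpos' : ∀ᶠ q in 𝓝 q₀, 0 < volumeFn g X (ψ q) :=
    (contDiffAt_volumeFn_comp hX hT hψ hq₀ hpos).continuousAt.eventually (lt_mem_nhds hpos)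
  have hΩ : {q | q ∈ T ∧ ψ q ∈ regularPart φ ∧ 0 < volumeFn g X (ψ q)} ∈ 𝓝 q₀ := by
    filter_upwards [hT.mem_nhds hq₀,
      hψc.eventually ((isOpen_regularPart φ).mem_nhds hreg), hpos'] with q h1 h2 h3
    exact ⟨h1, h2, h3⟩
  have hW : ∀ᶠ q in 𝓝 q₀, ContDiffAt ℝ ∞ (fun q => volumeFn g X (ψ q)) q := by
    filter_upwards [hΩ] with q hq
    exact contDiffAt_volumeFn_comp hX hT hψ hq.1 hq.2.2
  have hQ : ∀ᶠ y in 𝓝 (q₀, u s₁), ContDiffAt ℝ ∞ (fun y : E3 × E3 =>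
      orbitNormSq g X (ψ y.1) (mfderiv 𝓘(ℝ, E3) (𝓡 3) ψ y.1 y.2)) y := by
    have h1 : Tendsto (fun y : E3 × E3 => y.1) (𝓝 (q₀, u s₁)) (𝓝 q₀) :=
      continuous_fst.tendsto _
    filter_upwards [h1.eventually_mem hΩ] with y hy
    exact contDiffAt_orbitNormSq_comp hX hT hψ hy.1 hy.2.2
  have hUe : ∀ᶠ s in 𝓝 s₁, ContDiffAt ℝ ∞ U s := by
    filter_upwards [hI.mem_nhds hs₁] with s hs
    exact hU.contDiffAt (hI.mem_nhds hs)
  obtain ⟨w', hw'⟩ := hgrad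
  obtain ⟨w, rfl⟩ : ∃ w : E3, mfderiv 𝓘(ℝ, E3) (𝓡 3) ψ q₀ w = w' := hsurj w'
  have hψd : ∀ q ∈ T, MDifferentiableAt 𝓘(ℝ, E3) (𝓡 3) ψ q := fun q hq =>
    (hψ.contMDiffAt (hT.mem_nhds hq)).mdifferentiableAt (by simp)
  have hw := lt_of_lt_of_eq hw' (fderiv_volumeFn_comp hX (hψd q₀ hq₀) hpos w).symm
  have hCS := abs_orbitInner_le (inner_field_pos_of_volumeFn_pos hpos) hunorm
    (mfderiv 𝓘(ℝ, E3) (𝓡 3) ψ q₀ w)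
  -- With `w₁ = w` and `w₂ = u(s₁)` the determinant is `2(dω(w) - μU'⟨u, w⟩)`, positive because
  -- `|⟨u, w⟩| ≤ ‖w‖` and `dω(w) > |μU'| ‖w‖`.
  have hdet : 0 < fderiv ℝ (fun q => volumeFn g X (ψ q)) q₀ w *
      fderiv ℝ (fun y : E3 × E3 => orbitNormSq g X (ψ y.1) (mfderiv 𝓘(ℝ, E3) (𝓡 3) ψ y.1 y.2))
        (q₀, u s₁) (0, u s₁) - fderiv ℝ (fun q => volumeFn g X (ψ q)) q₀ (u s₁) *
      fderiv ℝ (fun y : E3 × E3 => orbitNormSq g X (ψ y.1) (mfderiv 𝓘(ℝ, E3) (𝓡 3) ψ y.1 y.2))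
        (q₀, u s₁) (0, w) := by
    rw [fderiv_orbitNormSq_comp hX hT hψ hq₀ hpos (u s₁) (u s₁),
      fderiv_orbitNormSq_comp hX hT hψ hq₀ hpos (u s₁) w, huvol]
    have h1 : orbitInner g X (ψ q₀) (mfderiv 𝓘(ℝ, E3) (𝓡 3) ψ q₀ (u s₁))
        (mfderiv 𝓘(ℝ, E3) (𝓡 3) ψ q₀ (u s₁)) = 1 := by
      rw [← hunorm, orbitNormSq_eq _ _ (inner_field_pos_of_volumeFn_pos hpos).ne', orbitInner, sq]
    rw [h1]
    have h2 := (le_abs_self _).trans ((abs_mul (μ₀ * deriv U s₁) _).le.trans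
      (mul_le_mul_of_nonneg_left hCS (abs_nonneg (μ₀ * deriv U s₁))))
    linarith
  have hw₁ : fderiv ℝ (fun q => volumeFn g X (ψ q)) q₀ w ≠ 0 :=
    ((mul_nonneg (abs_nonneg _) (Real.sqrt_nonneg _)).trans_lt hw).ne'
  obtain ⟨ε, hε, δ₁, hδ₁, c, hcc, hc₀, hc, hcu⟩ :=
    exists_curve_family hW hQ hUe hu hdet.ne' hw₁ huvol hunorm hvol hΩ
  obtain ⟨δ₂, hδ₂, hδI⟩ := Metric.mem_nhds_iff.1 (hI.mem_nhds hs₁)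
  rw [Real.ball_eq_Ioo] at hδI
  have hsub : Ioo (s₁ - min δ₁ δ₂) (s₁ + min δ₁ δ₂) ⊆
      Ioo (s₁ - δ₁) (s₁ + δ₁) ∩ Ioo (s₁ - δ₂) (s₁ + δ₂) := by
    intro x hx
    have := min_le_left δ₁ δ₂
    have := min_le_right δ₁ δ₂
    exact ⟨⟨by linarith [hx.1], by linarith [hx.2]⟩, ⟨by linarith [hx.1], by linarith [hx.2]⟩⟩
  refine ⟨ε, hε, min δ₁ δ₂, lt_min hδ₁ hδ₂, fun s hs => hδI (hsub hs).2, fun μ s => ψ (c μ s),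
    ?_, congrArg ψ hc₀, ?_, ?_⟩
  · exact hψ.continuousOn.comp (hcc.mono (prod_mono subset_rfl fun s hs => (hsub hs).1))
      fun y hy => ((hc y.1 hy.1).2 y.2 (hsub hy.2).1).1.1
  · rintro μ hμ m rfl
    obtain ⟨h1, h2⟩ := hc _ hμ
    refine ⟨hψ.comp (h1.contMDiffOn.mono fun s hs => (hsub hs).1)
      fun s hs => (h2 s (hsub hs).1).1.1, fun s hs => (h2 s (hsub hs).1).1.2.1,
      fun s hs => (h2 s (hsub hs).1).2.1, fun s hs => ?_⟩
    obtain ⟨h3, -, h4⟩ := h2 s (hsub hs).1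
    rw [velocity_comp (hψd _ h3.1)
      ((h1.contDiffAt (isOpen_Ioo.mem_nhds (hsub hs).1)).differentiableAt (by simp))]
    exact h4
  · intro c₀ hc₀' hce
    filter_upwards [hcu c₀ hc₀' hce] with s hs
    rw [hs]

theorem exists_profile_family (hX : IsKillingFlow g X φ) {U : ℝ → ℝ} {I : Set ℝ}
    (hI : IsOpen I) (hU : ContDiffOn ℝ ∞ U I) (hUpos : ∀ s ∈ I, 0 < U s) {m₀ : ℝ} (hm₀ : m₀ ≠ 0)
    {γ₀ : ℝ → N} (hγ₀ : IsProfile g X φ U m₀ I γ₀) {s₁ : ℝ} (hs₁ : s₁ ∈ I)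
    (hgrad : GradVolumeGT g X (γ₀ s₁) |m₀ * deriv U s₁|) :
    ∃ ε > 0, ∃ δ > 0, Ioo (s₁ - δ) (s₁ + δ) ⊆ I ∧ ∃ Γ : ℝ → ℝ → N,
      ContinuousOn (fun q : ℝ × ℝ => Γ q.1 q.2)
        (Ioo (m₀ - ε) (m₀ + ε) ×ˢ Ioo (s₁ - δ) (s₁ + δ)) ∧
      (∀ s ∈ Ioo (s₁ - δ) (s₁ + δ), Γ m₀ s = γ₀ s) ∧
      ∀ m ∈ Ioo (m₀ - ε) (m₀ + ε), m ≠ 0 ∧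
        IsProfile g X φ U m (Ioo (s₁ - δ) (s₁ + δ)) (Γ m) := by
  obtain ⟨ψ, χ, T, hT, hχT, hψχ, hψ, hχ, hsurj⟩ := exists_local_parametrization (γ₀ s₁)
  have hγ₀s : ∀ s ∈ I, ContMDiffAt 𝓘(ℝ, ℝ) (𝓡 3) ∞ γ₀ s := fun s hs =>
    hγ₀.contMDiffOn.contMDiffAt (hI.mem_nhds hs)
  have hγ₀t : Tendsto γ₀ (𝓝 s₁) (𝓝 (γ₀ s₁)) := (hγ₀s s₁ hs₁).continuousAt
  let c₀ : ℝ → E3 := fun s => χ (γ₀ s)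
  have hc₀s : ∀ᶠ s in 𝓝 s₁, ContDiffAt ℝ ∞ c₀ s := by
    filter_upwards [hI.mem_nhds hs₁, hγ₀t.eventually hχ] with s hs hs'
    exact (hs'.2.comp s (hγ₀s s hs)).contDiffAt
  have hψc : ∀ᶠ s in 𝓝 s₁, γ₀ s = ψ (c₀ s) := by
    filter_upwards [hγ₀t.eventually hχ] with s hs
    exact hs.1.symm
  have hcT : ∀ᶠ s in 𝓝 s₁, c₀ s ∈ T :=
    hc₀s.self_of_nhds.continuousAt.eventually_mem (hT.mem_nhds hχT)
  have hus : ∀ᶠ s in 𝓝 s₁, ContDiffAt ℝ ∞ (deriv c₀) s := by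
    filter_upwards [hc₀s] with s hs
    exact (hs.fderiv_right (m := ∞) (by simp)).clm_apply contDiffAt_const
  have hprof : ∀ᶠ s in 𝓝 s₁, HasDerivAt c₀ (deriv c₀ s) s ∧
      volumeFn g X (ψ (c₀ s)) = |m₀| * U s ∧
      orbitNormSq g X (ψ (c₀ s)) (mfderiv 𝓘(ℝ, E3) (𝓡 3) ψ (c₀ s) (deriv c₀ s)) = 1 := by
    filter_upwards [hI.mem_nhds hs₁, hc₀s, eventually_eventually_nhds.2 hψc, hcT] with s h1 h2 h3 h4
    have h5 : DifferentiableAt ℝ c₀ s := h2.differentiableAt (by simp)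
    refine ⟨h5.hasDerivAt, ?_, ?_⟩
    · rw [← h3.self_of_nhds]
      exact hγ₀.volume_eq s h1
    · rw [← velocity_comp ((hψ.contMDiffAt (hT.mem_nhds h4)).mdifferentiableAt (by simp)) h5]
      exact (orbitNormSq_velocity_congr h3).symm.trans (hγ₀.unit_speed s h1)
  have hvol := hprof.self_of_nhds.2.1
  have hμ₀ : 0 < |m₀| := abs_pos.2 hm₀
  have hpos : 0 < volumeFn g X (ψ (c₀ s₁)) := by
    rw [hvol]
    exact mul_pos hμ₀ (hUpos _ hs₁)
  have huvol : fderiv ℝ (fun q => volumeFn g X (ψ q)) (c₀ s₁) (deriv c₀ s₁)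
      = |m₀| * deriv U s₁ := by
    have h1 := ((contDiffAt_volumeFn_comp hX hT hψ hχT hpos).differentiableAt
      (by simp)).hasFDerivAt.comp_hasDerivAt s₁ hprof.self_of_nhds.1
    have h2 := ((hU.contDiffAt (hI.mem_nhds hs₁)).differentiableAt
      (by simp)).hasDerivAt.const_mul |m₀|
    have h3 : (fun q => volumeFn g X (ψ q)) ∘ c₀ =ᶠ[𝓝 s₁] fun s => |m₀| * U s :=
      hprof.mono fun s hs => hs.2.1
    exact (h1.congr_of_eventuallyEq h3.symm).unique h2
  have hgrad' : GradVolumeGT g X (ψ (c₀ s₁)) |(|m₀| * deriv U s₁)| := by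
    rw [abs_mul, abs_abs, ← abs_mul, ← hψc.self_of_nhds]
    exact hgrad
  have hreg : ψ (c₀ s₁) ∈ regularPart φ := by
    rw [← hψc.self_of_nhds]
    exact hγ₀.regular s₁ hs₁
  obtain ⟨ε, hε, δ₁, hδ₁, hδI, Γ, hΓc, -, hΓ, hΓu⟩ := exists_profile_family_in_chart hX hI hU hUpos
    hT hψ hχT hsurj hμ₀ hs₁ hreg hvol hgrad' hus hprof.self_of_nhds.2.2 huvol
  have hΓ₀ : ∀ᶠ s in 𝓝 s₁, Γ |m₀| s = γ₀ s := by
    filter_upwards [hΓu c₀ rfl hprof, hψc] with s h1 h2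
    rw [h1, h2]
  obtain ⟨δ₂, hδ₂, hδΓ⟩ := Metric.eventually_nhds_iff_ball.1 hΓ₀
  rw [Real.ball_eq_Ioo] at hδΓ
  have hsub : Ioo (s₁ - min δ₁ δ₂) (s₁ + min δ₁ δ₂) ⊆
      Ioo (s₁ - δ₁) (s₁ + δ₁) ∩ Ioo (s₁ - δ₂) (s₁ + δ₂) := by
    intro x hx
    have := min_le_left δ₁ δ₂
    have := min_le_right δ₁ δ₂
    exact ⟨⟨by linarith [hx.1], by linarith [hx.2]⟩, ⟨by linarith [hx.1], by linarith [hx.2]⟩⟩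
  -- The bound `|m₀|` on the radius keeps `m` away from zero.
  have hm : ∀ m ∈ Ioo (m₀ - min ε |m₀|) (m₀ + min ε |m₀|),
      m ≠ 0 ∧ |m| ∈ Ioo (|m₀| - ε) (|m₀| + ε) := by
    intro m hm
    have h1 : |m - m₀| < min ε |m₀| := by
      rw [abs_lt]
      constructor <;> linarith [hm.1, hm.2]
    have h2 := (abs_abs_sub_abs_le m m₀).trans_lt (h1.trans_le (min_le_left _ _))
    rw [abs_lt] at h2
    refine ⟨?_, by linarith, by linarith⟩
    rintro rfl
    have h3 := h1.trans_le (min_le_right _ _)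
    rw [zero_sub, abs_neg] at h3
    exact lt_irrefl _ h3
  refine ⟨min ε |m₀|, lt_min hε hμ₀, min δ₁ δ₂, lt_min hδ₁ hδ₂, fun s hs => hδI (hsub hs).1,
    fun m => Γ |m|, ?_, fun s hs => hδΓ s (hsub hs).2, fun m hm' => ⟨(hm m hm').1,
      (hΓ _ (hm m hm').2 m rfl).mono fun s hs => (hsub hs).1⟩⟩
  exact hΓc.comp (f := fun y : ℝ × ℝ => (|y.1|, y.2)) (by fun_prop)
    fun y hy => ⟨(hm _ hy.1).2, (hsub hy.2).1⟩

end

/-! ### Prescribed initial points and reparametrised profiles -/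

section

/-- In dimension at least three, the values of a linear functional on the unit vectors orthogonal
to a vector `x` in its kernel form an interval. -/
theorem exists_unit_orthogonal {V : Type*} [AddCommGroup V] [Module ℝ V] [FiniteDimensional ℝ V]
    (hV : 2 < Module.finrank ℝ V) (B : V →ₗ[ℝ] V →ₗ[ℝ] ℝ) (hsymm : ∀ v w, B v w = B w v)
    (hB : ∀ v, v ≠ 0 → 0 < B v v) {x : V} (hx : x ≠ 0) (D : V →ₗ[ℝ] ℝ) (hD : D x = 0)
    {d : ℝ} {w : V} (hw : |d| * √(B w w) < D w) :
    ∃ v, B v v = 1 ∧ B v x = 0 ∧ D v = d := by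
  have hxx := hB x hx
  -- `e` is the normalised projection of `w`: projecting along `x` keeps `D w`, because `D x = 0`,
  -- and does not increase the length.
  obtain ⟨e, he, hex, hed⟩ : ∃ e, B e e = 1 ∧ B e x = 0 ∧ |d| ≤ D e := by
    set h : V := w - (B w x / B x x) • x with hh
    have h1 : B h x = 0 := by
      simp only [hh, map_sub, map_smul, LinearMap.sub_apply, LinearMap.smul_apply, smul_eq_mul]
      field_simp
      ring
    have h2 : D h = D w := by simp [hh, hD]
    have h3 : B w w = B h h + (B w x / B x x) ^ 2 * B x x := by
      have : w = h + (B w x / B x x) • x := by simp [hh]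
      nth_rewrite 1 [this]
      nth_rewrite 2 [this]
      simp only [map_add, map_smul, LinearMap.add_apply, LinearMap.smul_apply, smul_eq_mul,
        hsymm x h, h1]
      ring
    have h4 : 0 < D h := by
      rw [h2]
      exact (mul_nonneg (abs_nonneg _) (Real.sqrt_nonneg _)).trans_lt hw
    have h5 : 0 < B h h := hB h (by rintro h0; simp [h0] at h4)
    have h6 : √(B h h) ≤ √(B w w) :=
      Real.sqrt_le_sqrt (by rw [h3]; nlinarith [sq_nonneg (B w x / B x x)])
    have h7 : 0 < √(B h h) := Real.sqrt_pos.2 h5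
    have h8 : √(B h h) ^ 2 = B h h := Real.sq_sqrt h5.le
    refine ⟨(√(B h h))⁻¹ • h, ?_, by simp [h1], ?_⟩
    · simp only [map_smul, LinearMap.smul_apply, smul_eq_mul]
      field_simp
      exact h8.symm
    · rw [map_smul, smul_eq_mul, h2, inv_mul_eq_div, le_div_iff₀ h7]
      exact (mul_le_mul_of_nonneg_left h6 (abs_nonneg d)).trans hw.le
  -- Here dimension at least three enters. The unit circle through `e` and `n` joins `e` to `-e`,
  -- and on it `D` passes from `D e ≥ |d|` to `-D e ≤ -|d|`.
  obtain ⟨n, hn, hnx, hne⟩ : ∃ n, B n n = 1 ∧ B n x = 0 ∧ B n e = 0 := by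
    obtain ⟨v, hv, hv0⟩ := (Submodule.ne_bot_iff _).1
      (LinearMap.ker_ne_bot_of_finrank_lt (f := (B.flip x).prod (B.flip e))
        (by rw [Module.finrank_prod, Module.finrank_self]; exact hV))
    have h1 : B v x = 0 ∧ B v e = 0 := by simpa using hv
    have h2 := hB v hv0
    have h3 : √(B v v) ^ 2 = B v v := Real.sq_sqrt h2.le
    have h4 : 0 < √(B v v) := Real.sqrt_pos.2 h2
    refine ⟨(√(B v v))⁻¹ • v, ?_, by simp [h1.1], by simp [h1.2]⟩
    simp only [map_smul, LinearMap.smul_apply, smul_eq_mul]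
    field_simp
    exact h3.symm
  obtain ⟨t, -, ht⟩ := intermediate_value_Icc' (f := fun t => Real.cos t * D e + Real.sin t * D n)
    Real.pi_pos.le (by fun_prop) (show d ∈ _ by
      simp only [Real.cos_pi, Real.sin_pi, Real.cos_zero, Real.sin_zero]
      rw [abs_le] at hed
      constructor <;> linarith [neg_abs_le d, le_abs_self d])
  refine ⟨Real.cos t • e + Real.sin t • n, ?_, by simp [hex, hnx], by simpa using ht⟩
  simp only [map_add, map_smul, LinearMap.add_apply, LinearMap.smul_apply, smul_eq_mul, he, hn, hne,
    hsymm e n]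
  linarith [Real.sin_sq_add_cos_sq t]

/-- If `T a < T b`, take for `c` the last point with `T ≤ T a` and `d = b`; the other case is the
mirror image. A mere minimum point of `T` need not be strict. -/
theorem ContinuousOn.exists_strict_min_endpoint {T : ℝ → ℝ} {a b : ℝ} (hab : a < b)
    (hT : ContinuousOn T (uIcc a b)) (h : T a ≠ T b) :
    ∃ c ∈ uIcc a b, ∃ d ∈ uIcc a b, c ≠ d ∧ ∀ s ∈ uIcc c d, s ≠ c → T c < T s := by
  rw [uIcc_of_le hab.le] at *
  rcases h.lt_or_gt with h | h
  · have hK : IsCompact (Icc a b ∩ T ⁻¹' Iic (T a)) :=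
      isCompact_Icc.of_isClosed_subset (hT.preimage_isClosed_of_isClosed isClosed_Icc isClosed_Iic)
        inter_subset_left
    obtain ⟨c, ⟨hc, hcT⟩, hcm⟩ := hK.exists_isGreatest ⟨a, left_mem_Icc.2 hab.le, le_refl (T a)⟩
    refine ⟨c, hc, b, right_mem_Icc.2 hab.le, ?_, fun s hs hsc => ?_⟩
    · rintro rfl
      exact absurd hcT (not_le.2 h)
    · rw [uIcc_of_le hc.2] at hs
      by_contra hlt
      exact hsc (le_antisymm (hcm ⟨⟨hc.1.trans hs.1, hs.2⟩, (not_lt.1 hlt).trans hcT⟩) hs.1)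
  · have hK : IsCompact (Icc a b ∩ T ⁻¹' Iic (T b)) :=
      isCompact_Icc.of_isClosed_subset (hT.preimage_isClosed_of_isClosed isClosed_Icc isClosed_Iic)
        inter_subset_left
    obtain ⟨c, ⟨hc, hcT⟩, hcm⟩ := hK.exists_isLeast ⟨b, right_mem_Icc.2 hab.le, le_refl (T b)⟩
    refine ⟨c, hc, a, left_mem_Icc.2 hab.le, ?_, fun s hs hsc => ?_⟩
    · rintro rfl
      exact absurd hcT (not_le.2 h)
    · rw [uIcc_of_ge hc.1] at hs
      by_contra hlt
      exact hsc (le_antisymm hs.2 (hcm ⟨⟨hs.1, hs.2.trans hc.2⟩, (not_lt.1 hlt).trans hcT⟩))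

variable {N : Type*} [TopologicalSpace N] [ChartedSpace E3 N] [IsManifold (𝓡 3) ∞ N]
  {g : Metric N} {X : (p : N) → TangentSpace (𝓡 3) p} {φ : ℝ → N → N}

theorem IsKillingFlow.exists_orbitNormSq_eq_one (hX : IsKillingFlow g X φ) {p : N}
    (hpos : 0 < volumeFn g X p) {d : ℝ} (h : GradVolumeGT g X p |d|) :
    ∃ v : TangentSpace (𝓡 3) p, orbitNormSq g X p v = 1 ∧
      mfderiv (𝓡 3) 𝓘(ℝ, ℝ) (volumeFn g X) p v = d := by
  obtain ⟨w, hw⟩ := h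
  have hA := inner_field_pos_of_volumeFn_pos hpos
  let G : E3 →L[ℝ] E3 →L[ℝ] ℝ := g.inner p
  let B : E3 →ₗ[ℝ] E3 →ₗ[ℝ] ℝ := (ContinuousLinearMap.coeLM ℝ).comp G.toLinearMap
  let D : E3 →L[ℝ] ℝ := mfderiv (𝓡 3) 𝓘(ℝ, ℝ) (volumeFn g X) p
  let x : E3 := X p
  have hx : x ≠ 0 := by
    intro h0
    have h1 : G x x = 0 := by rw [h0]; simp
    exact hA.ne' h1
  obtain ⟨v, h1, h2, h3⟩ := exists_unit_orthogonal (by simp) B (g.symm p) (g.pos p) hx D.toLinearMap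
    (hX.mfderiv_volumeFn_field hpos) hw
  refine ⟨v, (orbitNormSq_eq p v hA.ne').trans ?_, h3⟩
  change B v v - B v x ^ 2 / B x x = 1
  rw [h1, h2]
  simp

theorem exists_profile_of_gradVolumeGT (hX : IsKillingFlow g X φ) {U : ℝ → ℝ} {I : Set ℝ}
    (hI : IsOpen I) (hU : ContDiffOn ℝ ∞ U I) (hUpos : ∀ s ∈ I, 0 < U s) {m : ℝ} (hm : m ≠ 0)
    {s₁ : ℝ} (hs₁ : s₁ ∈ I) {p : N} (hp : p ∈ regularPart φ)
    (hvol : volumeFn g X p = |m| * U s₁) (hgrad : GradVolumeGT g X p |m * deriv U s₁|) :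
    ∃ δ > 0, Ioo (s₁ - δ) (s₁ + δ) ⊆ I ∧
      ∃ γ : ℝ → N, γ s₁ = p ∧ IsProfile g X φ U m (Ioo (s₁ - δ) (s₁ + δ)) γ := by
  obtain ⟨ψ, χ, T, hT, hχT, hψχ, hψ, -, hsurj⟩ := exists_local_parametrization p
  have hμ : 0 < |m| := abs_pos.2 hm
  generalize χ p = q₀ at hχT hψχ hsurj
  subst hψχ
  have hpos : 0 < volumeFn g X (ψ q₀) := by
    rw [hvol]
    exact mul_pos hμ (hUpos _ hs₁)
  have hgrad' : GradVolumeGT g X (ψ q₀) |(|m| * deriv U s₁)| := by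
    rwa [abs_mul, abs_abs, ← abs_mul]
  obtain ⟨v, hv, hvd⟩ := hX.exists_orbitNormSq_eq_one hpos hgrad'
  obtain ⟨u, rfl⟩ : ∃ u : E3, mfderiv 𝓘(ℝ, E3) (𝓡 3) ψ q₀ u = v := hsurj v
  obtain ⟨ε, hε, δ, hδ, hδI, Γ, -, hΓ₀, hΓ, -⟩ := exists_profile_family_in_chart hX hI hU hUpos
    hT hψ hχT hsurj hμ hs₁ hp hvol hgrad' (u := fun _ => u) (.of_forall fun _ => contDiffAt_const) hv
    ((fderiv_volumeFn_comp hX ((hψ.contMDiffAt (hT.mem_nhds hχT)).mdifferentiableAt (by simp))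
      hpos u).trans hvd)
  exact ⟨δ, hδ, hδI, Γ |m|, hΓ₀, hΓ _ ⟨by linarith, by linarith⟩ m rfl⟩

/-- The part of `γ'` orthogonal to `X` is a unit vector on which `dω` equals `|m| U'`; it or its
negative is the witness, according to the sign of `U'`. -/
theorem IsProfile.gradVolumeGT (hX : IsKillingFlow g X φ) {U : ℝ → ℝ} {I : Set ℝ}
    (hI : IsOpen I) {m : ℝ} {γ : ℝ → N} (hγ : IsProfile g X φ U m I γ) {s : ℝ} (hs : s ∈ I)
    (hU : DifferentiableAt ℝ U s) (hpos : 0 < volumeFn g X (γ s)) {r : ℝ}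
    (hr : r < |m * deriv U s|) : GradVolumeGT g X (γ s) r := by
  let D : E3 →L[ℝ] ℝ := mfderiv (𝓡 3) 𝓘(ℝ, ℝ) (volumeFn g X) (γ s)
  have hγd := (hγ.contMDiffOn.contMDiffAt (hI.mem_nhds hs)).mdifferentiableAt (by simp)
  have h1 : D (velocity γ s) = |m| * deriv U s := by
    have h2 := mfderiv_comp_apply s (hX.mdifferentiableAt_volumeFn hpos) hγd (1 : ℝ)
    have h3 := ((hX.mdifferentiableAt_volumeFn hpos).comp s hγd).differentiableAt.hasDerivAt
    have h4 : volumeFn g X ∘ γ =ᶠ[𝓝 s] fun s => |m| * U s := by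
      filter_upwards [hI.mem_nhds hs] with x hx
      exact hγ.volume_eq x hx
    rw [mfderiv_eq_fderiv] at h2
    exact h2.symm.trans ((h3.congr_of_eventuallyEq h4.symm).unique (hU.hasDerivAt.const_mul _))
  let G : E3 →L[ℝ] E3 →L[ℝ] ℝ := g.inner (γ s)
  let x : E3 := X (γ s)
  let v : E3 := velocity γ s
  let h : E3 := v - (G v x / G x x) • x
  have h2 : D h = |m| * deriv U s := by
    have h3 : D x = 0 := hX.mfderiv_volumeFn_field hpos
    rw [_root_.map_sub, _root_.map_smul, h3, smul_zero, sub_zero]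
    exact h1
  have h3 : G h h = 1 := hγ.unit_speed s hs
  rw [abs_mul] at hr
  rcases le_total 0 (deriv U s) with h0 | h0
  · refine ⟨h, ?_⟩
    change r * √(G h h) < D h
    rw [h3, h2]
    simpa [abs_of_nonneg h0] using hr
  · refine ⟨(-h : E3), ?_⟩
    change r * √(G (-h) (-h)) < D (-h)
    have h4 : G (-h) (-h) = 1 := by simpa using h3
    rw [h4, _root_.map_neg, h2]
    simpa [abs_of_nonpos h0] using hr

theorem IsProfile.comp_add_const {U : ℝ → ℝ} {I I' : Set ℝ} (hI : IsOpen I) {m m' : ℝ} {γ : ℝ → N}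
    (hγ : IsProfile g X φ U m I γ) {τ : ℝ} (hτ : ∀ s ∈ I', s + τ ∈ I)
    (hU : ∀ s ∈ I', |m| * U (s + τ) = |m'| * U s) :
    IsProfile g X φ U m' I' (fun s => γ (s + τ)) := by
  have hadd : ContMDiff 𝓘(ℝ, ℝ) 𝓘(ℝ, ℝ) ∞ fun s : ℝ => s + τ :=
    (contDiff_id.add contDiff_const).contMDiff
  refine ⟨hγ.contMDiffOn.comp hadd.contMDiffOn hτ, fun s hs => hγ.regular _ (hτ s hs),
    fun s hs => (hγ.volume_eq _ (hτ s hs)).trans (hU s hs), fun s hs => ?_⟩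
  have h1 : velocity (fun s => γ (s + τ)) s = velocity γ (s + τ) := by
    have h2 := mfderiv_comp_apply s ((hγ.contMDiffOn.contMDiffAt
      (hI.mem_nhds (hτ s hs))).mdifferentiableAt (by simp))
      (hadd.mdifferentiable (by simp) s) (1 : ℝ)
    refine h2.trans (congrArg (mfderiv 𝓘(ℝ, ℝ) (𝓡 3) γ (s + τ)) ?_)
    rw [mfderiv_eq_fderiv, fderiv_add_const]
    exact congrArg (fun L : ℝ →L[ℝ] ℝ => L 1) fderiv_id
  rw [h1]
  exact hγ.unit_speed _ (hτ s hs)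

end

/-! ### An interval of parameters -/

section

variable {N : Type*} [TopologicalSpace N] [ChartedSpace E3 N] [IsManifold (𝓡 3) ∞ N]
  {g : Metric N} {X : (p : N) → TangentSpace (𝓡 3) p} {φ : ℝ → N → N}

theorem eq_mul_exp_of_deriv_eq_mul {U : ℝ → ℝ} {a b k : ℝ}
    (hU : ∀ s ∈ Ioo a b, HasDerivAt U (k * U s) s) {s s' : ℝ} (hs : s ∈ Ioo a b)
    (hs' : s' ∈ Ioo a b) : U s' = Real.exp (k * (s' - s)) * U s := by
  have h1 : ∀ x ∈ Ioo a b, HasDerivAt (fun x => U x * Real.exp (-(k * x))) 0 x := by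
    intro x hx
    have h2 : HasDerivAt (fun x : ℝ => -(k * x)) (-k) x := by
      simpa using ((hasDerivAt_id' x).const_mul k).fun_neg
    refine ((hU x hx).fun_mul h2.exp).congr_deriv ?_
    ring
  have h3 := isOpen_Ioo.is_const_of_deriv_eq_zero isPreconnected_Ioo
    (fun x hx => (h1 x hx).differentiableAt.differentiableWithinAt)
    (fun x hx => (h1 x hx).deriv) hs' hs
  have h4 : U s' = (U s' * Real.exp (-(k * s'))) * Real.exp (k * s') := by
    rw [mul_assoc, ← Real.exp_add]
    simp
  rw [h4, h3, mul_assoc, ← Real.exp_add, mul_comm]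
  congr 2
  ring

/-- Points of `γ₀` itself serve as initial points at another time, and comparing `L = U'/U` at the
two times decides nondegeneracy. This covers the case where `γ₀` attains equality in the gradient
bound, so that `exists_profile_family` does not apply. -/
theorem exists_profile_interval_of_deriv_ne_zero (hX : IsKillingFlow g X φ) {U : ℝ → ℝ} {I : Set ℝ}
    (hI : IsOpen I) (hU : ContDiffOn ℝ ∞ U I) (hUpos : ∀ s ∈ I, 0 < U s) {m₀ : ℝ} (hm₀ : m₀ ≠ 0)
    {γ₀ : ℝ → N} (hγ₀ : IsProfile g X φ U m₀ I γ₀) {s₁ : ℝ} (hs₁ : s₁ ∈ I)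
    (hU₁ : deriv U s₁ ≠ 0) :
    ∃ s₂ ∈ I, ∃ m₁ : ℝ, m₁ ≠ m₀ ∧ ∀ m ∈ uIcc m₀ m₁, m ≠ 0 ∧
      ∃ δ > 0, Ioo (s₂ - δ) (s₂ + δ) ⊆ I ∧
        ∃ γ : ℝ → N, IsProfile g X φ U m (Ioo (s₂ - δ) (s₂ + δ)) γ := by
  have hUs : ∀ s ∈ I, ContDiffAt ℝ ∞ U s := fun s hs => hU.contDiffAt (hI.mem_nhds hs)
  have hUd : ∀ s ∈ I, DifferentiableAt ℝ U s := fun s hs => (hUs s hs).differentiableAt (by simp)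
  set L : ℝ → ℝ := fun s => deriv U s / U s with hL
  have hLU : ∀ s ∈ I, deriv U s = L s * U s := fun s hs => (div_mul_cancel₀ _ (hUpos s hs).ne').symm
  have hLc : ∀ s ∈ I, ContinuousAt L s := fun s hs =>
    ((((hUs s hs).fderiv_right (m := ∞) (by simp)).clm_apply
      contDiffAt_const).continuousAt (f := deriv U)).div (hUs s hs).continuousAt (hUpos s hs).ne'
  have hL₁ : L s₁ ≠ 0 := div_ne_zero hU₁ (hUpos s₁ hs₁).ne'
  -- On this neighbourhood `L` keeps the sign of `L s₁`, so `L²` determines `L`, and `U'` has no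
  -- zero.
  obtain ⟨η, hη, hηI⟩ := Metric.eventually_nhds_iff_ball.1 ((hI.eventually_mem hs₁).and
    (((hLc s₁ hs₁).mul_const (L s₁)).eventually (lt_mem_nhds (mul_self_pos.2 hL₁))))
  rw [Real.ball_eq_Ioo] at hηI
  by_cases hconst : ∀ s ∈ Ioo (s₁ - η) (s₁ + η), L s ^ 2 = L s₁ ^ 2
  · have hLk : ∀ s ∈ Ioo (s₁ - η) (s₁ + η), L s = L s₁ := fun s hs => by
      rcases sq_eq_sq_iff_eq_or_eq_neg.1 (hconst s hs) with h | h
      · exact h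
      · have h1 := (hηI s hs).2
        rw [h] at h1
        nlinarith [sq_nonneg (L s₁)]
    have hexp := fun s s' => eq_mul_exp_of_deriv_eq_mul (s := s) (s' := s') (k := L s₁)
      fun s (hs : s ∈ Ioo (s₁ - η) (s₁ + η)) => by
        rw [← hLk s hs, ← hLU s (hηI s hs).1]
        exact (hUd s (hηI s hs).1).hasDerivAt
    -- Here `U` is exponential with rate `L s₁`, so shifting `γ₀` by `τ ∈ [0, η/2]` gives a profile
    -- for `m₀ exp(L s₁ τ)`.
    refine ⟨s₁, hs₁, m₀ * Real.exp (L s₁ * (η / 2)), ?_, fun m hm => ?_⟩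
    · rw [Ne, mul_eq_left₀ hm₀, Real.exp_eq_one_iff]
      exact mul_ne_zero hL₁ (half_pos hη).ne'
    · have h1 := intermediate_value_uIcc (a := 0) (b := η / 2)
        (f := fun τ => m₀ * Real.exp (L s₁ * τ)) (by fun_prop)
      simp only [mul_zero, Real.exp_zero, mul_one] at h1
      obtain ⟨τ, hτ, rfl⟩ := h1 hm
      rw [uIcc_of_le (half_pos hη).le] at hτ
      have h2 : ∀ s ∈ Ioo (s₁ - η / 2) (s₁ + η / 2), s ∈ Ioo (s₁ - η) (s₁ + η) ∧
          s + τ ∈ Ioo (s₁ - η) (s₁ + η) := by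
        rintro s ⟨h3, h4⟩
        obtain ⟨h5, h6⟩ := hτ
        exact ⟨⟨by linarith, by linarith⟩, by linarith, by linarith⟩
      refine ⟨mul_ne_zero hm₀ (Real.exp_pos _).ne', η / 2, half_pos hη,
        fun s hs => (hηI s (h2 s hs).1).1, fun s => γ₀ (s + τ),
        hγ₀.comp_add_const hI (fun s hs => (hηI _ (h2 s hs).2).1) fun s hs => ?_⟩
      rw [hexp s (s + τ) (h2 s hs).1 (h2 s hs).2, abs_mul, Real.abs_exp, add_sub_cancel_left,
        mul_assoc]
  · push Not at hconst
    obtain ⟨s', hs', hne⟩ := hconst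
    have hs₁η : s₁ ∈ Ioo (s₁ - η) (s₁ + η) := ⟨by linarith, by linarith⟩
    obtain ⟨a, ha, b, hb, hab, hTab⟩ : ∃ a ∈ Ioo (s₁ - η) (s₁ + η), ∃ b ∈ Ioo (s₁ - η) (s₁ + η),
        a < b ∧ L a ^ 2 ≠ L b ^ 2 := by
      rcases lt_trichotomy s' s₁ with h | h | h
      · exact ⟨s', hs', s₁, hs₁η, h, hne⟩
      · exact absurd (by rw [h]) hne
      · exact ⟨s₁, hs₁η, s', hs', h, hne.symm⟩
    have hsub := ordConnected_Ioo.uIcc_subset ha hb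
    obtain ⟨s₂, h₂, s₃, h₃, h₂₃, hmin⟩ := ContinuousOn.exists_strict_min_endpoint
      (T := fun s => L s ^ 2) hab
      (fun s hs => ((hLc s (hηI s (hsub hs)).1).pow 2).continuousWithinAt) hTab
    have hsub' : uIcc s₂ s₃ ⊆ Ioo (s₁ - η) (s₁ + η) :=
      (ordConnected_Ioo.uIcc_subset (hsub h₂) (hsub h₃))
    have hI₂ := (hηI s₂ (hsub h₂)).1
    have hU₂ := hUpos s₂ hI₂
    -- Rolle's theorem and `U' ≠ 0`; this makes the interval of values `m₀ U(s) / U(s₂)`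
    -- nondegenerate.
    have hU₂₃ : U s₂ ≠ U s₃ := by
      intro h
      have h1 : ∃ c ∈ uIcc s₂ s₃, deriv U c = 0 := by
        have hc : ContinuousOn U (uIcc s₂ s₃) := fun s hs =>
          (hUd s (hηI s (hsub' hs)).1).continuousAt.continuousWithinAt
        rcases h₂₃.lt_or_gt with hlt | hlt
        · rw [uIcc_of_le hlt.le] at *
          obtain ⟨c, hc, hc0⟩ := exists_deriv_eq_zero hlt hc h
          exact ⟨c, Ioo_subset_Icc_self hc, hc0⟩
        · rw [uIcc_of_ge hlt.le] at *
          obtain ⟨c, hc, hc0⟩ := exists_deriv_eq_zero hlt hc h.symm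
          exact ⟨c, Ioo_subset_Icc_self hc, hc0⟩
      obtain ⟨c, hc, hc0⟩ := h1
      have h2 := (hηI c (hsub' hc)).2
      simp [hL, hc0] at h2
    have hdiv : m₀ * U s₂ / U s₂ = m₀ := mul_div_cancel_right₀ _ hU₂.ne'
    refine ⟨s₂, hI₂, m₀ * U s₃ / U s₂, ?_, fun m hm => ?_⟩
    · intro h
      rw [div_eq_iff hU₂.ne'] at h
      exact hU₂₃ (mul_left_cancel₀ hm₀ h).symm
    · have h1 := intermediate_value_uIcc (a := s₂) (b := s₃) (f := fun s => m₀ * U s / U s₂)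
        fun s hs => (((hUd s (hηI s (hsub' hs)).1).continuousAt.const_mul m₀).div_const
          _).continuousWithinAt
      simp only [hdiv] at h1
      obtain ⟨s, hs, rfl⟩ := h1 hm
      have hsI := (hηI s (hsub' hs)).1
      have hUs' := hUpos s hsI
      have hm' : m₀ * U s / U s₂ ≠ 0 := div_ne_zero (mul_ne_zero hm₀ hUs'.ne') hU₂.ne'
      refine ⟨hm', ?_⟩
      -- At `s = s₂` the strict inequality fails, but then `m = m₀` and `γ₀` itself is the profile.
      rcases eq_or_ne s s₂ with rfl | hss₂
      · obtain ⟨δ, hδ, hδI⟩ := Metric.isOpen_iff.1 hI s hsI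
        rw [Real.ball_eq_Ioo] at hδI
        beta_reduce
        rw [hdiv]
        exact ⟨δ, hδ, hδI, γ₀, hγ₀.mono hδI⟩
      · have hvol : volumeFn g X (γ₀ s) = |m₀ * U s / U s₂| * U s₂ := by
          rw [hγ₀.volume_eq s hsI, abs_div, abs_mul, abs_of_pos hUs', abs_of_pos hU₂]
          field_simp
        have hpos : 0 < volumeFn g X (γ₀ s) := by
          rw [hvol]
          exact mul_pos (abs_pos.2 hm') hU₂
        obtain ⟨δ, hδ, hδI, γ, -, hγ⟩ := exists_profile_of_gradVolumeGT hX hI hU hUpos hm' hI₂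
          (hγ₀.regular s hsI) hvol (hγ₀.gradVolumeGT hX hI hsI (hUd s hsI) hpos (by
            have h2 : m₀ * U s / U s₂ * deriv U s₂ = m₀ * U s * L s₂ := by
              rw [hL]
              ring
            rw [h2, hLU s hsI, mul_comm (L s), ← mul_assoc, abs_mul, abs_mul (m₀ * U s)]
            exact mul_lt_mul_of_pos_left (sq_lt_sq.1 (hmin s hs hss₂))
              (abs_pos.2 (mul_ne_zero hm₀ hUs'.ne'))))
        exact ⟨δ, hδ, hδI, γ, hγ⟩

theorem exists_profile_interval (hX : IsKillingFlow g X φ) {U : ℝ → ℝ} {I : Set ℝ}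
    (hI : IsOpen I) (hU : ContDiffOn ℝ ∞ U I) (hUpos : ∀ s ∈ I, 0 < U s) {m₀ : ℝ} (hm₀ : m₀ ≠ 0)
    {γ₀ : ℝ → N} (hγ₀ : IsProfile g X φ U m₀ I γ₀) {s₁ : ℝ} (hs₁ : s₁ ∈ I)
    (hgrad : GradVolumeGT g X (γ₀ s₁) 0) :
    ∃ s₂ ∈ I, ∃ m₁ : ℝ, m₁ ≠ m₀ ∧ ∀ m ∈ uIcc m₀ m₁, m ≠ 0 ∧
      ∃ δ > 0, Ioo (s₂ - δ) (s₂ + δ) ⊆ I ∧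
        ∃ γ : ℝ → N, IsProfile g X φ U m (Ioo (s₂ - δ) (s₂ + δ)) γ := by
  by_cases hU₁ : deriv U s₁ = 0
  · obtain ⟨ε, hε, δ, hδ, hδI, Γ, -, -, hΓ⟩ := exists_profile_family hX hI hU hUpos hm₀ hγ₀ hs₁
      (by rwa [hU₁, mul_zero, abs_zero])
    refine ⟨s₁, hs₁, m₀ + ε / 2, by linarith, fun m hm => ?_⟩
    rw [uIcc_of_le (by linarith)] at hm
    obtain ⟨h1, h2⟩ := hΓ m ⟨by linarith [hm.1], by linarith [hm.2]⟩
    exact ⟨h1, δ, hδ, hδI, Γ m, h2⟩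
  · exact exists_profile_interval_of_deriv_ne_zero hX hI hU hUpos hm₀ hγ₀ hs₁ hU₁

end

end Bour

/-! ### Assembly -/

theorem theoremA
    {N : Type*} [TopologicalSpace N] [T2Space N] [ConnectedSpace N]
    [ChartedSpace Bour.E3 N] [IsManifold (𝓡 3) ∞ N]
    (g : Bour.Metric N) (X : (p : N) → TangentSpace (𝓡 3) p) (φ : ℝ → N → N)
    (hX : Bour.IsKillingFlow g X φ)
    {M : Type*} [TopologicalSpace M] [ChartedSpace (EuclideanSpace ℝ (Fin 2)) M]
    [IsManifold (𝓡 2) ∞ M] (θ : ℝ → M → M) (f : M → N)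
    (hf : Bour.IsEquivariantImmersion (E := EuclideanSpace ℝ (Fin 2)) φ θ f)
    (I J : Set ℝ) (hI : Bour.IsOpenInterval I) (hJ : Bour.IsOpenInterval J)
    (U : ℝ → ℝ) (hU : ContDiffOn ℝ ∞ U I) (hUpos : ∀ s ∈ I, 0 < U s)
    (σ : ℝ × ℝ → M) (hσ : ContMDiffOn 𝓘(ℝ, ℝ × ℝ) (𝓡 2) ∞ σ (I ×ˢ J))
    (hnat : Bour.IsNatural g X U (I ×ˢ J) (f ∘ σ)) :
    -- every solution of the system gives an invariant surface isometric to `M`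
    (∀ m : ℝ, m ≠ 0 → ∀ (I' : Set ℝ) (hI' : Bour.IsOpenInterval I'), I' ⊆ I →
      ∀ γ : ℝ → N, Bour.IsProfile g X φ U m I' γ → ∀ s₀ ∈ I', ∀ c : ℝ,
        Bour.IsEquivariantImmersion (E := ℝ × ℝ) φ (Bour.stripAction I' hI'.isOpen m)
          (fun z : Bour.strip I' hI'.isOpen => Bour.bourMap g X φ U m γ s₀ c z) ∧
        Bour.IsNatural g X U (I' ×ˢ univ) (Bour.bourMap g X φ U m γ s₀ c) ∧
        ∀ z ∈ I' ×ˢ J, ∀ w w' : ℝ × ℝ,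
          Bour.firstForm g (f ∘ σ) z w w'
            = Bour.firstForm g (Bour.bourMap g X φ U m γ s₀ c) z w w') ∧
    -- every invariant surface with this metric in natural parameters arises in this way
    (∀ I' J' : Set ℝ, Bour.IsOpenInterval I' → I' ⊆ I → Bour.IsOpenInterval J' →
      ∀ F : ℝ × ℝ → N, (∀ z ∈ I' ×ˢ J', F z ∈ Bour.regularPart φ) →
        Bour.IsNatural g X U (I' ×ˢ J') F →
        ∃ m : ℝ, m ≠ 0 ∧ ∃ γ : ℝ → N, Bour.IsProfile g X φ U m I' γ ∧
          ∃ s₀ ∈ I', ∃ c : ℝ, ∀ z ∈ I' ×ˢ J', F z = Bour.bourMap g X φ U m γ s₀ c z) ∧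
    -- solutions exist near prescribed nondegenerate initial data, for any `m`
    (∀ m : ℝ, m ≠ 0 → ∀ s₁ ∈ I, ∀ p ∈ Bour.regularPart φ,
      Bour.volumeFn g X p = |m| * U s₁ → Bour.GradVolumeGT g X p |m * deriv U s₁| →
        ∃ δ > 0, Ioo (s₁ - δ) (s₁ + δ) ⊆ I ∧
          ∃ γ : ℝ → N, γ s₁ = p ∧ Bour.IsProfile g X φ U m (Ioo (s₁ - δ) (s₁ + δ)) γ) ∧
    -- the family contains `M`, and members exist for a whole interval of parameters
    ∃ m₀ : ℝ, m₀ ≠ 0 ∧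
      ((∀ z ∈ I ×ˢ J, mfderiv 𝓘(ℝ, ℝ × ℝ) (𝓡 3) (f ∘ σ) z ((0, 1) : ℝ × ℝ) = X (f (σ z))) →
        m₀ = 1) ∧
      ∃ γ₀ : ℝ → N, Bour.IsProfile g X φ U m₀ I γ₀ ∧
      (∃ s₀ ∈ I, ∃ c : ℝ, ∀ z ∈ I ×ˢ J, f (σ z) = Bour.bourMap g X φ U m₀ γ₀ s₀ c z) ∧
      -- around a nondegenerate point of the profile curve of `M`: a continuous family,
      -- on a common interval, for all parameters close to that of `M`
      (∀ s₁ ∈ I, Bour.GradVolumeGT g X (γ₀ s₁) |m₀ * deriv U s₁| →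
        ∃ ε > 0, ∃ δ > 0, Ioo (s₁ - δ) (s₁ + δ) ⊆ I ∧
          ∃ Γ : ℝ → ℝ → N,
            ContinuousOn (fun q : ℝ × ℝ => Γ q.1 q.2)
              (Ioo (m₀ - ε) (m₀ + ε) ×ˢ Ioo (s₁ - δ) (s₁ + δ)) ∧
            (∀ s ∈ Ioo (s₁ - δ) (s₁ + δ), Γ m₀ s = γ₀ s) ∧
            ∀ m ∈ Ioo (m₀ - ε) (m₀ + ε), m ≠ 0 ∧
              Bour.IsProfile g X φ U m (Ioo (s₁ - δ) (s₁ + δ)) (Γ m)) ∧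
      -- in all cases, unless `ω` is critical along all of `M`: members for all parameters in a
      -- nondegenerate interval with end point `m₀`
      ((∃ s₁ ∈ I, Bour.GradVolumeGT g X (γ₀ s₁) 0) →
        ∃ s₂ ∈ I, ∃ m₁ : ℝ, m₁ ≠ m₀ ∧ ∀ m ∈ uIcc m₀ m₁, m ≠ 0 ∧
          ∃ δ > 0, Ioo (s₂ - δ) (s₂ + δ) ⊆ I ∧
            ∃ γ : ℝ → N, Bour.IsProfile g X φ U m (Ioo (s₂ - δ) (s₂ + δ)) γ) := by
  have hreg : ∀ z ∈ I ×ˢ J, (f ∘ σ) z ∈ Bour.regularPart φ := fun z _ => hf.regular (σ z)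
  refine ⟨fun m hm I' hI' hsub γ hγ s₀ hs₀ c => ?_, fun I' J' hI' hsub hJ' F hF hFnat => ?_,
    fun m hm s₁ hs₁ p hp hvol hgrad =>
      Bour.exists_profile_of_gradVolumeGT hX hI.isOpen hU hUpos hm hs₁ hp hvol hgrad, ?_⟩
  · have hU' := hU.mono hsub
    have hUpos' : ∀ s ∈ I', 0 < U s := fun s hs => hUpos s (hsub hs)
    have hψ := Bour.bourMap_isNatural hX hI' hU' hUpos' hm hγ hs₀ c
    refine ⟨Bour.bourMap_isEquivariantImmersion hX hI' hU' hUpos' hm hγ hs₀ c, hψ,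
      fun z hz w w' => ?_⟩
    rw [hnat.metric z ⟨hsub hz.1, hz.2⟩, hψ.metric z ⟨hz.1, mem_univ _⟩]
  · obtain ⟨m, hm, -, h⟩ := Bour.exists_profile_of_isNatural hX hI' hJ'
      (fun s hs => hUpos s (hsub hs)) hF hFnat
    exact ⟨m, hm, h⟩
  · obtain ⟨m₀, hm₀, hm₀X, γ₀, hγ₀, hγ₀F⟩ :=
      Bour.exists_profile_of_isNatural hX hI hJ hUpos hreg hnat
    refine ⟨m₀, hm₀, fun h => ?_, γ₀, hγ₀, hγ₀F,
      fun s₁ hs₁ hgrad => Bour.exists_profile_family hX hI.isOpen hU hUpos hm₀ hγ₀ hs₁ hgrad,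
      fun ⟨s₁, hs₁, hgrad⟩ =>
        Bour.exists_profile_interval hX hI.isOpen hU hUpos hm₀ hγ₀ hs₁ hgrad⟩
    obtain ⟨s, hs⟩ := hI.nonempty
    obtain ⟨t, ht⟩ := hJ.nonempty
    have hz : (s, t) ∈ I ×ˢ J := ⟨hs, ht⟩
    have h1 := hnat.metric (s, t) hz (0, 1) (0, 1)
    have h2 := (hm₀X (s, t) hz).symm.trans (h (s, t) hz)
    -- Since `‖∂_t‖ = U > 0`, the field does not vanish, so `m₀⁻¹ X = X` determines `m₀ = 1`.
    have hX0 : X (f (σ (s, t))) ≠ 0 := by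
      intro h0
      rw [Bour.firstForm, h (s, t) hz] at h1
      have h3 : g.inner (f (σ (s, t))) (X (f (σ (s, t)))) (X (f (σ (s, t)))) = 0 := by
        rw [h0]
        simp
      have h4 := h1.symm.trans h3
      simp [(hUpos s hs).ne'] at h4
    have h5 : (m₀⁻¹ - 1) • X (f (σ (s, t))) = 0 := by
      rw [sub_smul, one_smul, sub_eq_zero]
      exact h2
    rcases smul_eq_zero.1 h5 with h6 | h6
    · rwa [sub_eq_zero, inv_eq_one] at h6
    · exact absurd h6 hX0
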